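/- Let $\mathcal S$ be a countable set and $Q=(q(x,y))_{x,y\in\mathcal S}$ a $Q$-matrix on $\mathcal S$: $q(x,y)\ge 0$ for $x\ne y$, $q_x:=\sum_{y\ne x}q(x,y)<\infty$ and $q(x,x)=-q_x$. Assume that $Q$ is irreducible and that the associated continuous time Markov chain is positive recurrent (every non-absorbing state has a finite mean return time). Put $p(x,y)=q(x,y)/q_x$ for $x\ne y$ and $p(x,x)=0$. Let $(C(t),M(t))_{t\ge 0}$ (cat and mouse) be a continuous time (right-continuous, non-explosive) Markov chain on $\mathcal S^2$, with any initial distribution, whose infinitesimal generator is $$\Omega(f)(x,y)=\mathbf 1_{\{x\ne y\}}\sum_{z}q(x,z)\,[f(z,y)-f(x,y)]+\mathbf 1_{\{x=y\}}\sum_{z,z'}q_x\,p(x,z)\,p(x,z')\,[f(z,z')-f(x,x)]$$ for $f$ on $\mathcal S^2$ with finite support. (If $\mathcal S$ has a single point, so that $q_x=0$, then $\Omega=0$ and both processes are constant.) For $t\ge 0$ set $$U(t)=\int_0^t\mathbf 1_{\{M(s)=C(s)\}}\,ds,\qquad S(t)=\inf\{s>0:\ U(s)\ge t\}.$$ Then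 almost surely $S(t)<\infty$ and $U(S(t))=t$ for all $t\ge0$, and $(M(S(t)))_{t\ge 0}$ is a Markov chain with $Q$-matrix $Q$ such that almost surely $M(S(0))=M(0)$, just as $(C(t))_{t\ge0}$ is a Markov chain with $Q$-matrix $Q$. Consequently $(M(S(t)))_{t\ge 0}$ has the same distribution, as a process (that is, on $\mathcal S^{[0,\infty)}$ with the product $\sigma$-algebra), as any Markov chain with $Q$-matrix $Q$ whose initial distribution is that of $M(0)$; in particular it has the same distribution as $(C(t))_{t\ge0}$ if $C(0)$ and $M(0)$ have the same distribution. -/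

import Mathlib

open MeasureTheory ProbabilityTheory
open scoped NNReal ENNReal Classical

noncomputable section

namespace CatMouse

/-- A (conservative) `Q`-matrix on `E`: the off-diagonal entries are nonnegative and every row is
summable with sum `0`, so that `-q x x = ∑_{y ≠ x} q x y` is finite. -/
structure IsQMatrix {E : Type*} (q : E → E → ℝ) : Prop where
  nonneg : ∀ x y, x ≠ y → 0 ≤ q x y
  hasSum_row : ∀ x, HasSum (q x) 0

/-- The exit rate `q_x = ∑_{y ≠ x} q(x, y)`. -/
def exitRate {E : Type*} (q : E → E → ℝ) (x : E) : ℝ :=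
  ∑' y : {y : E // y ≠ x}, q x y

/-- The transition matrix of the underlying discrete time chain: `p(x, y) = q(x, y) / q_x` for
`y ≠ x` and `p(x, x) = 0`. The usual convention is made for an absorbing state (`q_x = 0`),
where the chain stays for ever. -/
def jumpMatrix {E : Type*} (q : E → E → ℝ) (x y : E) : ℝ :=
  if exitRate q x = 0 then (if y = x then 1 else 0)
  else (if y = x then 0 else q x y / exitRate q x)

/-- `Y` is the sequence of visited states and `T` the sequence of holding times of a Markov chain
with `Q`-matrix `q`: `Y` is a Markov chain with transition matrix `jumpMatrix q` and, conditionally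
on `Y`, the `T k` are independent and exponential with parameters `exitRate q (Y k)` (an
exponential variable with parameter `0` is infinite). -/
structure IsJumpHold {E : Type*} [MeasurableSpace E] {Ω : Type*} [MeasurableSpace Ω]
    (q : E → E → ℝ) (Y : ℕ → Ω → E) (T : ℕ → Ω → ℝ≥0∞) (P : Measure Ω) : Prop where
  measurable_state : ∀ n, Measurable (Y n)
  measurable_hold : ∀ n, Measurable (T n)
  law : ∀ (n : ℕ) (i : ℕ → E) (t : ℕ → ℝ≥0),
    P {ω | ∀ k ≤ n, Y k ω = i k ∧ (t k : ℝ≥0∞) < T k ω} =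
      P {ω | Y 0 ω = i 0} *
        (∏ k ∈ Finset.range n, ENNReal.ofReal (jumpMatrix q (i k) (i (k + 1)))) *
        ∏ k ∈ Finset.range (n + 1), ENNReal.ofReal (Real.exp (-(exitRate q (i k) * t k)))

/-- The process `X = (X t)_{t ≥ 0}` is, under `P`, a continuous time (right-continuous,
non-explosive) Markov chain with `Q`-matrix `q`, with arbitrary initial distribution: almost
surely, the holding times of a jump chain `Y` with `Q`-matrix `q` add up to `∞`, and `X` sits at
`Y n` between its `n`-th jump time (included) and the next one (excluded). -/
def IsMarkovChain {E : Type*} [MeasurableSpace E] {Ω : Type*} [MeasurableSpace Ω]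
    (q : E → E → ℝ) (X : ℝ≥0 → Ω → E) (P : Measure Ω) : Prop :=
  ∃ (Y : ℕ → Ω → E) (T : ℕ → Ω → ℝ≥0∞), IsJumpHold q Y T P ∧
    ∀ᵐ ω ∂P, ∑' k, T k ω = ∞ ∧
      ∀ (t : ℝ≥0) (n : ℕ), ∑ k ∈ Finset.range n, T k ω ≤ t →
        t < ∑ k ∈ Finset.range (n + 1), T k ω → X t ω = Y n ω

/-- Every state can be reached from every state. -/
def IsIrreducible {E : Type*} (q : E → E → ℝ) : Prop :=
  ∀ x y, Relation.ReflTransGen (fun a b => a ≠ b ∧ 0 < q a b) x y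

/-- The first time at which the path is at `x` after having been elsewhere (`∞` if there is none);
for a chain started at `x` this is the return time to `x`. -/
def returnTime {E Ω : Type*} (X : ℝ≥0 → Ω → E) (x : E) (ω : Ω) : ℝ≥0∞ :=
  ⨅ (t : ℝ≥0) (_ : X t ω = x ∧ ∃ s < t, X s ω ≠ x), (t : ℝ≥0∞)

/-- The state `x` is positive recurrent for `q`: it is absorbing, or the Markov chain with
`Q`-matrix `q` started at `x` returns to `x` in finite mean time. (The law of that chain does not
depend on the probability space that carries it.) -/
def IsPositiveRecurrentState {E : Type*} [MeasurableSpace E] (q : E → E → ℝ) (x : E) : Prop :=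
  exitRate q x = 0 ∨
    ∃ (Ω : Type) (_ : MeasurableSpace Ω) (P : Measure Ω) (X : ℝ≥0 → Ω → E),
      IsProbabilityMeasure P ∧ IsMarkovChain q X P ∧ (∀ᵐ ω ∂P, X 0 ω = x) ∧
        ∫⁻ ω, returnTime X x ω ∂P < ∞

/-- The infinitesimal generator of the cat and mouse chain. Away from the diagonal only the cat
(first coordinate) moves, with rates `q`; on the diagonal, at `(x, x)`, cat and mouse jump
together at rate `q_x` to independent positions with distribution `p(x, ·)`. -/
def catMouseGenerator {E : Type*} (q : E → E → ℝ) (f : E × E → ℝ) (a : E × E) : ℝ :=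
  if a.1 = a.2 then
    ∑' z : E × E, exitRate q a.1 * jumpMatrix q a.1 z.1 * jumpMatrix q a.1 z.2 * (f z - f a)
  else
    ∑' z : E, q a.1 z * (f (z, a.2) - f a)

/-- The `Q`-matrix of the cat and mouse chain: its entry at `(a, b)` is the value at `a` of the
generator applied to the indicator function of `b`. -/
def catMouseMatrix {E : Type*} (q : E → E → ℝ) (a b : E × E) : ℝ :=
  catMouseGenerator q (fun z => if z = b then 1 else 0) a

/-- The time `U(t) = ∫₀ᵗ 1_{M(s) = C(s)} ds` up to `t` that cat and mouse spend together. -/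
def timeTogether {E Ω : Type*} (C M : ℝ≥0 → Ω → E) (t : ℝ≥0) (ω : Ω) : ℝ≥0∞ :=
  ∫⁻ s in Set.Icc (0 : ℝ) t, (if M s.toNNReal ω = C s.toNNReal ω then 1 else 0)

/-- `S(t) = inf {s > 0 : U(s) ≥ t}`. -/
def inverseTime {E Ω : Type*} (C M : ℝ≥0 → Ω → E) (t : ℝ≥0) (ω : Ω) : ℝ≥0 :=
  sInf {s : ℝ≥0 | 0 < s ∧ (t : ℝ≥0∞) ≤ timeTogether C M s ω}

theorem exitRate_eq {E : Type*} {q : E → E → ℝ} (hq : IsQMatrix q) (x : E) :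
    exitRate q x = -q x x := by
  have h1 : HasSum (fun y => q x y - (if y = x then q x x else 0)) (0 - q x x) :=
    (hq.hasSum_row x).sub (hasSum_ite_eq x (q x x))
  have h2 : (fun y => q x y - (if y = x then q x x else 0)) = Set.indicator {y | y ≠ x} (q x) := by
    funext y
    by_cases h : y = x
    · subst h; simp
    · simp [h, Set.indicator]
  rw [h2] at h1
  have h3 := (tsum_subtype {y | y ≠ x} (q x)).trans h1.tsum_eq
  rw [zero_sub] at h3
  exact h3

theorem hasSum_jumpMatrix {E : Type*} {q : E → E → ℝ} (hq : IsQMatrix q) (x : E) :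
    HasSum (jumpMatrix q x) 1 := by
  by_cases h0 : exitRate q x = 0
  · have : jumpMatrix q x = fun y => if y = x then 1 else 0 := by
      funext y; simp [jumpMatrix, h0]
    rw [this]; exact hasSum_ite_eq x 1
  · have h1 : HasSum (fun y => q x y - (if y = x then q x x else 0)) (0 - q x x) :=
      (hq.hasSum_row x).sub (hasSum_ite_eq x (q x x))
    have h2 := h1.div_const (exitRate q x)
    have h3 : (0 - q x x) / exitRate q x = 1 := by
      rw [zero_sub, ← exitRate_eq hq x, div_self h0]
    rw [h3] at h2
    have h4 : jumpMatrix q x =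
        fun y => (q x y - (if y = x then q x x else 0)) / exitRate q x := by
      funext y
      by_cases h : y = x
      · subst h; simp [jumpMatrix, h0]
      · simp [jumpMatrix, h, h0]
    rw [h4]
    exact h2

/-- Away from the diagonal only the cat moves. -/
theorem catMouseMatrix_of_ne {E : Type*} {q : E → E → ℝ} (hq : IsQMatrix q) {x y : E}
    (h : x ≠ y) (b : E × E) :
    catMouseMatrix q (x, y) b = if b.2 = y then q x b.1 else 0 := by
  have h1 : HasSum (fun z => if z = b.1 then (if b.2 = y then q x b.1 else 0) else 0)
      (if b.2 = y then q x b.1 else 0) := hasSum_ite_eq b.1 _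
  have h2 := h1.sub ((hq.hasSum_row x).mul_right (if ((x, y) : E × E) = b then (1 : ℝ) else 0))
  rw [zero_mul, sub_zero] at h2
  rw [← h2.tsum_eq]
  simp only [catMouseMatrix, catMouseGenerator, if_neg h]
  refine tsum_congr fun z => ?_
  rw [mul_sub]
  congr 1
  obtain ⟨b1, b2⟩ := b
  by_cases hz : z = b1
  · subst hz
    by_cases hy : b2 = y
    · subst hy; simp
    · simp [hy, Ne.symm hy]
  · simp [hz]

/-- On the diagonal both move, independently, at rate `q_x`. -/
theorem catMouseMatrix_diag {E : Type*} {q : E → E → ℝ} (hq : IsQMatrix q) (x : E) (b : E × E) :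
    catMouseMatrix q (x, x) b =
      exitRate q x * (jumpMatrix q x b.1 * jumpMatrix q x b.2 - if (x, x) = b then 1 else 0) := by
  have hs : Summable (fun z : E × E => jumpMatrix q x z.1 * jumpMatrix q x z.2) :=
    summable_mul_of_summable_norm (hasSum_jumpMatrix hq x).summable.norm
      (hasSum_jumpMatrix hq x).summable.norm
  have hp : HasSum (fun z : E × E => jumpMatrix q x z.1 * jumpMatrix q x z.2) 1 := by
    simpa using (hasSum_jumpMatrix hq x).mul (hasSum_jumpMatrix hq x) hs
  have h1 : HasSum (fun z => if z = b then jumpMatrix q x b.1 * jumpMatrix q x b.2 else 0)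
      (jumpMatrix q x b.1 * jumpMatrix q x b.2) := hasSum_ite_eq b _
  have h2 := (h1.sub (hp.mul_right (if (x, x) = b then (1 : ℝ) else 0))).mul_left (exitRate q x)
  rw [one_mul] at h2
  rw [← h2.tsum_eq]
  simp only [catMouseMatrix, catMouseGenerator, if_true]
  refine tsum_congr fun z => ?_
  by_cases hz : z = b
  · subst hz
    by_cases hx : (x, x) = z
    · subst hx; simp
    · simp [hx]; ring
  · simp only [hz, if_false]
    by_cases hx : (x, x) = b
    · simp only [hx, if_true]; ring
    · simp only [hx, if_false]; ring

end CatMouse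

end

set_option linter.unusedSectionVars false

/-! Let `Y n` be the successive states of the pair and `T n` its holding times. The exit rate at
`(x, y)` is `q_x` whether or not `x = y`, and in both cases the cat's next position has law `p(x,
·)`; so the cat is a chain with `Q`-matrix `q` (`IsJumpHold.cat`).

For the mouse, list only the meetings, i.e. the indices with `Y k` on the diagonal. A meeting at
`(x, x)` lasts an exponential time of parameter `q_x`; then the mouse jumps according to `p(x, ·)`
and waits there until the cat arrives. The next meeting therefore takes place where the mouse
landed, wherever the cat went in between: the places and durations of the meetings form again a jump
chain with `Q`-matrix `q` (`law_meetings`, `IsJumpHold.meetings`). This requires infinitely many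
meetings. While they are apart the mouse is a fixed target, and a finite mean return time together
with irreducibility makes the cat hit every point (`iInf_avoidProb_diag`).

The meeting durations must also add up to `∞`. The law of states and holding times is determined by
`q` and the initial distribution (`IsJumpHold.map_eq`), and positive recurrence supplies, from each
non-absorbing state, a chain that does not explode; at an absorbing state the first holding time is
already infinite (`IsJumpHold.tsum_hold_eq_top`).

What remains is a statement about single paths (`IsMeetingPath.inverseTime_spec`): the time change
by `S` erases the periods apart, so `M(S(t))` is the place of the `n`-th meeting while `t` runs
through the `n`-th duration. At the left end of that duration `S(t)` is in general the end of the
previous meeting, not the start of the `n`-th; by right-continuity the mouse has then already jumped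
to its new place. -/

namespace CatMouse

/-! ### The `Q`-matrix of the pair: exit rates and jump probabilities. -/

section QMatrix

variable {E : Type*} {q : E → E → ℝ}

theorem exitRate_nonneg (hq : IsQMatrix q) (x : E) : 0 ≤ exitRate q x :=
  tsum_nonneg fun y => hq.nonneg x y y.2.symm

theorem jumpMatrix_nonneg (hq : IsQMatrix q) (x y : E) : 0 ≤ jumpMatrix q x y := by
  unfold jumpMatrix
  split_ifs with h1 h2 h2
  · exact zero_le_one
  · exact le_rfl
  · exact le_rfl
  · exact div_nonneg (hq.nonneg x y (Ne.symm h2)) (exitRate_nonneg hq x)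

theorem tsum_ofReal_jumpMatrix (hq : IsQMatrix q) (x : E) :
    ∑' y, ENNReal.ofReal (jumpMatrix q x y) = 1 := by
  rw [← ENNReal.ofReal_tsum_of_nonneg (jumpMatrix_nonneg hq x) (hasSum_jumpMatrix hq x).summable,
    (hasSum_jumpMatrix hq x).tsum_eq, ENNReal.ofReal_one]

theorem exitRate_mul_jumpMatrix_self (x : E) : exitRate q x * jumpMatrix q x x = 0 := by
  by_cases h : exitRate q x = 0 <;> simp [jumpMatrix, h]

/-- In an irreducible chain with an absorbing state there is only one state. -/
theorem subsingleton_of_exitRate_eq_zero (hq : IsQMatrix q) (hirr : IsIrreducible q) {x : E}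
    (hx : exitRate q x = 0) : Subsingleton E := by
  have key : ∀ y, y = x := by
    intro y
    rcases Relation.ReflTransGen.cases_head (hirr x y) with h | ⟨z, ⟨hz, hz'⟩, -⟩
    · exact h.symm
    · exfalso
      have hs : Summable (fun y : {y : E // y ≠ x} => q x y) := (hq.hasSum_row x).summable.subtype _
      have h1 := hs.le_tsum ⟨z, hz.symm⟩ fun y _ => hq.nonneg x y y.2.symm
      unfold exitRate at hx
      simp only at h1
      linarith
  exact ⟨fun a b => (key a).trans (key b).symm⟩

theorem isQMatrix_catMouseMatrix (hq : IsQMatrix q) : IsQMatrix (catMouseMatrix q) where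
  nonneg := by
    rintro ⟨x, y⟩ b hb
    by_cases h : x = y
    · subst h
      rw [catMouseMatrix_diag hq, if_neg hb, sub_zero]
      exact mul_nonneg (exitRate_nonneg hq x)
        (mul_nonneg (jumpMatrix_nonneg hq _ _) (jumpMatrix_nonneg hq _ _))
    · rw [catMouseMatrix_of_ne hq h]
      split_ifs with h2
      · refine hq.nonneg _ _ fun h3 => hb ?_
        rw [h3, ← h2]
      · exact le_rfl
  hasSum_row := by
    rintro ⟨x, y⟩
    by_cases h : x = y
    · subst h
      have hs : Summable (fun z : E × E => jumpMatrix q x z.1 * jumpMatrix q x z.2) :=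
        summable_mul_of_summable_norm (hasSum_jumpMatrix hq x).summable.norm
          (hasSum_jumpMatrix hq x).summable.norm
      have hp : HasSum (fun z : E × E => jumpMatrix q x z.1 * jumpMatrix q x z.2) 1 := by
        simpa using (hasSum_jumpMatrix hq x).mul (hasSum_jumpMatrix hq x) hs
      have h1 : HasSum (fun b : E × E => if (x, x) = b then (1 : ℝ) else 0) 1 := by
        simpa only [eq_comm] using hasSum_ite_eq (x, x) (1 : ℝ)
      have h2 := (hp.sub h1).mul_left (exitRate q x)
      rw [sub_self, mul_zero] at h2
      refine h2.congr_fun fun b => ?_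
      rw [catMouseMatrix_diag hq]
    · have hinj : Function.Injective (fun z : E => (z, y)) := fun a b hab => congrArg Prod.fst hab
      rw [← hinj.hasSum_iff]
      · refine (hq.hasSum_row x).congr_fun fun z => ?_
        simp [catMouseMatrix_of_ne hq h]
      · rintro ⟨z, w⟩ hz
        rw [catMouseMatrix_of_ne hq h, if_neg]
        rintro rfl
        exact hz ⟨z, rfl⟩

/-- On the diagonal no part of the rate `q_x` is lost to a joint jump back to `(x, x)`, because `q_x
p(x, x) = 0` even in the absorbing case. -/
theorem exitRate_catMouseMatrix (hq : IsQMatrix q) (a : E × E) :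
    exitRate (catMouseMatrix q) a = exitRate q a.1 := by
  obtain ⟨x, y⟩ := a
  rw [exitRate_eq (isQMatrix_catMouseMatrix hq)]
  by_cases h : x = y
  · subst h
    rw [catMouseMatrix_diag hq]
    have := exitRate_mul_jumpMatrix_self (q := q) x
    simp only [if_true]
    linear_combination -jumpMatrix q x x * this
  · rw [catMouseMatrix_of_ne hq h, exitRate_eq hq]
    simp

theorem jumpMatrix_catMouseMatrix_diag (hq : IsQMatrix q) (x : E) (b : E × E) :
    jumpMatrix (catMouseMatrix q) (x, x) b = jumpMatrix q x b.1 * jumpMatrix q x b.2 := by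
  obtain ⟨b1, b2⟩ := b
  rw [jumpMatrix, exitRate_catMouseMatrix hq, catMouseMatrix_diag hq]
  by_cases h0 : exitRate q x = 0
  · by_cases h1 : b1 = x <;> by_cases h2 : b2 = x <;> simp [h0, h1, h2, jumpMatrix]
  · simp only [h0, if_false]
    by_cases hb : (b1, b2) = (x, x)
    · obtain ⟨rfl, rfl⟩ := Prod.mk.inj hb
      simp [jumpMatrix, h0]
    · rw [if_neg hb, if_neg (Ne.symm hb)]
      field_simp
      ring

theorem jumpMatrix_catMouseMatrix_of_ne (hq : IsQMatrix q) {x y : E} (h : x ≠ y) (b : E × E) :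
    jumpMatrix (catMouseMatrix q) (x, y) b = if b.2 = y then jumpMatrix q x b.1 else 0 := by
  obtain ⟨b1, b2⟩ := b
  rw [jumpMatrix, exitRate_catMouseMatrix hq, catMouseMatrix_of_ne hq h]
  by_cases h0 : exitRate q x = 0
  · by_cases h1 : b1 = x <;> by_cases h2 : b2 = y <;> simp [h0, h1, h2, jumpMatrix]
  · by_cases h1 : b1 = x <;> by_cases h2 : b2 = y <;> simp [h0, h1, h2, jumpMatrix]

/-- The probability that the chain, started at `i 0`, follows the path `i` for `n` steps, with
holding times larger than `t`. -/
noncomputable def pathWeight (q : E → E → ℝ) (n : ℕ) (i : ℕ → E) (t : ℕ → ℝ≥0) : ℝ≥0∞ :=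
  (∏ k ∈ Finset.range n, ENNReal.ofReal (jumpMatrix q (i k) (i (k + 1)))) *
    ∏ k ∈ Finset.range (n + 1), ENNReal.ofReal (Real.exp (-(exitRate q (i k) * t k)))

theorem pathWeight_zero (i : ℕ → E) (t : ℕ → ℝ≥0) :
    pathWeight q 0 i t = ENNReal.ofReal (Real.exp (-(exitRate q (i 0) * t 0))) := by
  simp [pathWeight]

/-- First-step decomposition, on which the inductions over cylinders rest. -/
theorem pathWeight_succ (n : ℕ) (i : ℕ → E) (t : ℕ → ℝ≥0) :
    pathWeight q (n + 1) i t = ENNReal.ofReal (Real.exp (-(exitRate q (i 0) * t 0))) *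
      ENNReal.ofReal (jumpMatrix q (i 0) (i 1)) *
        pathWeight q n (fun k => i (k + 1)) (fun k => t (k + 1)) := by
  rw [pathWeight, pathWeight, Finset.prod_range_succ', Finset.prod_range_succ' _ (n + 1)]
  simp only [zero_add]
  ring

end QMatrix

/-! ### Jump chains under restriction of the measure, and the Markov property. -/

section Fibers

variable {Ω F : Type*} [MeasurableSpace Ω] {P : Measure Ω} [MeasurableSpace F] [Countable F]
  [MeasurableSingletonClass F]

theorem tsum_measure_and_eq {f : Ω → F} (hf : Measurable f) {p : Ω → Prop}
    (hp : MeasurableSet {ω | p ω}) : ∑' b, P {ω | p ω ∧ f ω = b} = P {ω | p ω} := by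
  rw [← measure_iUnion]
  · congr 1
    ext ω
    simp
  · intro a b hab
    refine Set.disjoint_left.2 fun ω h1 h2 => hab ?_
    exact h1.2.symm.trans h2.2
  · intro b
    exact hp.inter (hf (measurableSet_singleton b))

end Fibers

section JumpHold

variable {E : Type*} [MeasurableSpace E] {Ω : Type*} [MeasurableSpace Ω] {q : E → E → ℝ}
  {Y : ℕ → Ω → E} {T : ℕ → Ω → ℝ≥0∞} {P : Measure Ω}

theorem IsJumpHold.law_pathWeight (h : IsJumpHold q Y T P) (n : ℕ) (i : ℕ → E) (t : ℕ → ℝ≥0) :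
    P {ω | ∀ k ≤ n, Y k ω = i k ∧ (t k : ℝ≥0∞) < T k ω} =
      P {ω | Y 0 ω = i 0} * pathWeight q n i t := by
  rw [h.law, mul_assoc]; rfl

theorem isJumpHold_of_law_pathWeight (hY : ∀ n, Measurable (Y n)) (hT : ∀ n, Measurable (T n))
    (h : ∀ (n : ℕ) (i : ℕ → E) (t : ℕ → ℝ≥0),
      P {ω | ∀ k ≤ n, Y k ω = i k ∧ (t k : ℝ≥0∞) < T k ω} =
        P {ω | Y 0 ω = i 0} * pathWeight q n i t) : IsJumpHold q Y T P :=
  ⟨hY, hT, fun n i t => by rw [h, mul_assoc]; rfl⟩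

/-- The defining identity is homogeneous in the measure. Normalization is thus irrelevant, and
conditioning can be replaced by restriction. -/
theorem IsJumpHold.smul (h : IsJumpHold q Y T P) (c : ℝ≥0∞) : IsJumpHold q Y T (c • P) := by
  refine isJumpHold_of_law_pathWeight h.measurable_state h.measurable_hold fun n i t => ?_
  simp only [Measure.smul_apply, smul_eq_mul, h.law_pathWeight, mul_assoc]

variable [Countable E] [MeasurableSingletonClass E]

theorem measurableSet_cylinder (hY : ∀ n, Measurable (Y n)) (hT : ∀ n, Measurable (T n))
    (n : ℕ) (i : ℕ → E) (t : ℕ → ℝ≥0) :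
    MeasurableSet {ω | ∀ k ≤ n, Y k ω = i k ∧ (t k : ℝ≥0∞) < T k ω} := by
  have : {ω | ∀ k ≤ n, Y k ω = i k ∧ (t k : ℝ≥0∞) < T k ω} =
      ⋂ k, ⋂ (_ : k ≤ n), (Y k ⁻¹' {i k} ∩ T k ⁻¹' Set.Ioi (t k : ℝ≥0∞)) := by
    ext ω; simp
  rw [this]
  exact MeasurableSet.iInter fun k => MeasurableSet.iInter fun _ =>
    (hY k (measurableSet_singleton _)).inter (hT k measurableSet_Ioi)

theorem IsJumpHold.measurableSet_state (h : IsJumpHold q Y T P) (n : ℕ) (D : Set E) :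
    MeasurableSet {ω | Y n ω ∈ D} := h.measurable_state n (.of_discrete)

theorem IsJumpHold.measurableSet_eq (h : IsJumpHold q Y T P) (n : ℕ) (a : E) :
    MeasurableSet {ω | Y n ω = a} := h.measurable_state n (measurableSet_singleton a)

theorem IsJumpHold.law_zero (h : IsJumpHold q Y T P) (a : E) (t : ℝ≥0) :
    P {ω | Y 0 ω = a ∧ (t : ℝ≥0∞) < T 0 ω} =
      P {ω | Y 0 ω = a} * ENNReal.ofReal (Real.exp (-(exitRate q a * t))) := by
  have := h.law_pathWeight 0 (fun _ => a) (fun _ => t)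
  simpa [pathWeight_zero] using this

/-- If the chain is a jump chain on each of countably many pieces, then it is one. -/
theorem isJumpHold_of_fibers {F : Type*} [MeasurableSpace F] [Countable F]
    [MeasurableSingletonClass F] {X : Ω → F} (hX : Measurable X) (hY : ∀ n, Measurable (Y n))
    (hT : ∀ n, Measurable (T n))
    (h : ∀ a, IsJumpHold q Y T (P.restrict {ω | X ω = a})) : IsJumpHold q Y T P := by
  refine isJumpHold_of_law_pathWeight hY hT fun n i t => ?_
  have h1 := measurableSet_cylinder hY hT n i t
  have h2 : MeasurableSet {ω | Y 0 ω = i 0} := hY 0 (measurableSet_singleton _)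
  rw [← tsum_measure_and_eq hX h1, ← tsum_measure_and_eq hX h2, ← ENNReal.tsum_mul_right]
  refine tsum_congr fun a => ?_
  have := (h a).law_pathWeight n i t
  rwa [Measure.restrict_apply h1, Measure.restrict_apply h2] at this

theorem IsJumpHold.restrict_mem (h : IsJumpHold q Y T P) (D : Set E) :
    IsJumpHold q Y T (P.restrict {ω | Y 0 ω ∈ D}) := by
  refine isJumpHold_of_law_pathWeight h.measurable_state h.measurable_hold fun n i t => ?_
  rw [Measure.restrict_apply (measurableSet_cylinder h.measurable_state h.measurable_hold n i t),
    Measure.restrict_apply (h.measurableSet_eq 0 _)]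
  by_cases hD : i 0 ∈ D
  · have h1 : {ω | ∀ k ≤ n, Y k ω = i k ∧ (t k : ℝ≥0∞) < T k ω} ∩ {ω | Y 0 ω ∈ D} =
        {ω | ∀ k ≤ n, Y k ω = i k ∧ (t k : ℝ≥0∞) < T k ω} := by
      refine Set.inter_eq_left.2 fun ω hω => ?_
      rw [Set.mem_ofPred_eq, (hω 0 n.zero_le).1]
      exact hD
    have h2 : {ω | Y 0 ω = i 0} ∩ {ω | Y 0 ω ∈ D} = {ω | Y 0 ω = i 0} := by
      refine Set.inter_eq_left.2 fun ω hω => ?_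
      rw [Set.mem_ofPred_eq, hω]
      exact hD
    erw [h1, h2]
    exact h.law_pathWeight n i t
  · have h1 : {ω | ∀ k ≤ n, Y k ω = i k ∧ (t k : ℝ≥0∞) < T k ω} ∩ {ω | Y 0 ω ∈ D} = ∅ := by
      refine Set.eq_empty_iff_forall_notMem.2 fun ω hω => hD ?_
      rw [← (hω.1 0 n.zero_le).1]
      exact hω.2
    have h2 : {ω | Y 0 ω = i 0} ∩ {ω | Y 0 ω ∈ D} = ∅ := by
      refine Set.eq_empty_iff_forall_notMem.2 fun ω hω => hD ?_
      rw [← show Y 0 ω = i 0 from hω.1]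
      exact hω.2
    erw [h1, h2]
    simp

variable [IsFiniteMeasure P]

/-- At threshold `0` the exponential factor is `1`, so requiring `0 < T 0` loses no mass on `{Y 0 =
a}`. -/
theorem IsJumpHold.hold_zero_pos (h : IsJumpHold q Y T P) : ∀ᵐ ω ∂P, 0 < T 0 ω := by
  have key : ∀ a, ∀ᵐ ω ∂P, ω ∈ {ω | Y 0 ω = a ∧ ((0 : ℝ≥0) : ℝ≥0∞) < T 0 ω} ↔
      ω ∈ {ω | Y 0 ω = a} := by
    intro a
    refine Filter.EventuallyEq.mem_iff (ae_eq_of_subset_of_measure_ge (fun ω hω => hω.1) ?_ ?_ ?_)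
    · rw [h.law_zero]; simp
    · exact ((h.measurable_state 0 (measurableSet_singleton a)).inter
        (h.measurable_hold 0 measurableSet_Ioi)).nullMeasurableSet
    · exact measure_ne_top _ _
  filter_upwards [ae_all_iff.2 key] with ω hω
  simpa using ((hω (Y 0 ω)).2 rfl).2

/-- One step of the chain. -/
theorem IsJumpHold.law_step (hq : IsQMatrix q) (h : IsJumpHold q Y T P) (a b : E) (t : ℝ≥0) :
    P {ω | (Y 0 ω = a ∧ (t : ℝ≥0∞) < T 0 ω) ∧ Y 1 ω = b} =
      P {ω | Y 0 ω = a} * ENNReal.ofReal (Real.exp (-(exitRate q a * t))) *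
        ENNReal.ofReal (jumpMatrix q a b) := by
  have hB : MeasurableSet {ω | Y 0 ω = a ∧ (t : ℝ≥0∞) < T 0 ω} :=
    (h.measurable_state 0 (measurableSet_singleton a)).inter
        (h.measurable_hold 0 measurableSet_Ioi)
  have hB' : MeasurableSet {ω | (Y 0 ω = a ∧ (t : ℝ≥0∞) < T 0 ω) ∧ 0 < T 1 ω} :=
    hB.inter (h.measurable_hold 1 measurableSet_Ioi)
  have h1 : ∀ b, P {ω | ((Y 0 ω = a ∧ (t : ℝ≥0∞) < T 0 ω) ∧ 0 < T 1 ω) ∧ Y 1 ω = b} =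
      P {ω | Y 0 ω = a} * ENNReal.ofReal (Real.exp (-(exitRate q a * t))) *
        ENNReal.ofReal (jumpMatrix q a b) := by
    intro b
    have h2 := h.law_pathWeight 1 (fun k => if k = 0 then a else b) (fun k => if k = 0 then t else 0)
    rw [pathWeight_succ, pathWeight_zero] at h2
    simp only [if_true, one_ne_zero, if_false, zero_add, NNReal.coe_zero, mul_zero, neg_zero,
      Real.exp_zero, ENNReal.ofReal_one, mul_one] at h2
    rw [mul_assoc, ← h2]
    congr 1
    ext ω
    simp only [Set.mem_ofPred_eq]
    constructor
    · rintro ⟨⟨h3, h4⟩, h5⟩ k hk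
      interval_cases k
      · simpa using h3
      · simpa using ⟨h5, h4⟩
    · intro h3
      have h4 := h3 0 (by norm_num)
      have h5 := h3 1 le_rfl
      simp only [if_true, one_ne_zero, if_false, ENNReal.coe_zero] at h4 h5
      exact ⟨⟨h4, h5.2⟩, h5.1⟩
  -- Cylinders always constrain `T 1`. Summed over the next state, the transition probabilities give
  -- `1`, so the constraint `0 < T 1` costs nothing.
  have h3 : P {ω | (Y 0 ω = a ∧ (t : ℝ≥0∞) < T 0 ω) ∧ 0 < T 1 ω} =
      P {ω | Y 0 ω = a ∧ (t : ℝ≥0∞) < T 0 ω} := by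
    rw [← tsum_measure_and_eq (h.measurable_state 1) hB', h.law_zero, tsum_congr h1,
      ENNReal.tsum_mul_left, tsum_ofReal_jumpMatrix hq, mul_one]
  have h4 := (ae_eq_of_subset_of_measure_ge (μ := P) (fun ω hω => hω.1) h3.ge
    hB'.nullMeasurableSet (measure_ne_top _ _)).mem_iff
  rw [← h1]
  refine measure_congr (Filter.eventuallyEq_set.2 ?_)
  filter_upwards [h4] with ω hω
  exact and_congr_left fun _ => hω.symm

/-- The Markov property after one step. -/
theorem IsJumpHold.shift_restrict_lt (hq : IsQMatrix q) (h : IsJumpHold q Y T P) (a : E)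
    (t : ℝ≥0) :
    IsJumpHold q (fun k => Y (k + 1)) (fun k => T (k + 1))
      (P.restrict {ω | Y 0 ω = a ∧ (t : ℝ≥0∞) < T 0 ω}) := by
  refine isJumpHold_of_law_pathWeight (fun n => h.measurable_state _)
    (fun n => h.measurable_hold _) fun n i s => ?_
  rw [Measure.restrict_apply (measurableSet_cylinder (fun n => h.measurable_state _)
    (fun n => h.measurable_hold _) n i s),
    Measure.restrict_apply (h.measurableSet_eq _ _)]
  -- The path `i` and the thresholds `s`, preceded by the state `a` and the threshold `t`.
  have h1 := h.law_pathWeight (n + 1) (fun k => Nat.rec a (fun k _ => i k) k)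
    (fun k => Nat.rec t (fun k _ => s k) k)
  rw [pathWeight_succ] at h1
  have h2 := h.law_step hq a (i 0) t
  have h3 : {ω | Y (0 + 1) ω = i 0} ∩ {ω | Y 0 ω = a ∧ (t : ℝ≥0∞) < T 0 ω} =
      {ω | (Y 0 ω = a ∧ (t : ℝ≥0∞) < T 0 ω) ∧ Y 1 ω = i 0} := Set.inter_comm _ _
  erw [h3, h2]
  rw [mul_assoc, mul_assoc, ← mul_assoc (ENNReal.ofReal _) (ENNReal.ofReal _)]
  refine Eq.trans ?_ h1
  congr 1
  ext ω
  simp only [Set.mem_inter_iff, Set.mem_ofPred_eq]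
  constructor
  · rintro ⟨h4, h5⟩ k hk
    cases k with
    | zero => exact h5
    | succ k => exact h4 k (by omega)
  · intro h4
    exact ⟨fun k hk => h4 (k + 1) (by omega), h4 0 (by omega)⟩

/-- The one-step Markov property with threshold `0`, which is almost surely exceeded, glued over the
values of the initial state. -/
theorem IsJumpHold.shift_restrict_mem (hq : IsQMatrix q) (h : IsJumpHold q Y T P) (D : Set E) :
    IsJumpHold q (fun k => Y (k + 1)) (fun k => T (k + 1)) (P.restrict {ω | Y 0 ω ∈ D}) := by
  have h1 := h.restrict_mem D
  refine isJumpHold_of_fibers (h.measurable_state 0) (fun n => h.measurable_state _)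
    (fun n => h.measurable_hold _) fun a => ?_
  have h2 := h1.shift_restrict_lt hq a 0
  have h3 : (P.restrict {ω | Y 0 ω ∈ D}).restrict {ω | Y 0 ω = a} =
      (P.restrict {ω | Y 0 ω ∈ D}).restrict {ω | Y 0 ω = a ∧ ((0 : ℝ≥0) : ℝ≥0∞) < T 0 ω} := by
    refine Measure.restrict_congr_set (Filter.eventuallyEq_set.2 ?_)
    filter_upwards [h1.hold_zero_pos] with ω hω
    exact ⟨fun h4 => ⟨h4, hω⟩, fun h4 => h4.1⟩
  rwa [h3]

theorem IsJumpHold.shift (hq : IsQMatrix q) (h : IsJumpHold q Y T P) :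
    IsJumpHold q (fun k => Y (k + 1)) (fun k => T (k + 1)) P := by
  have := h.shift_restrict_mem hq Set.univ
  simpa using this

theorem IsJumpHold.shift_add (hq : IsQMatrix q) (h : IsJumpHold q Y T P) (N : ℕ) :
    IsJumpHold q (fun k => Y (k + N)) (fun k => T (k + N)) P := by
  induction N with
  | zero => exact h
  | succ N ih =>
    have := ih.shift hq
    simpa only [add_right_comm, add_assoc] using this

theorem IsJumpHold.hold_pos (hq : IsQMatrix q) (h : IsJumpHold q Y T P) :
    ∀ᵐ ω ∂P, ∀ k, 0 < T k ω :=
  ae_all_iff.2 fun k => by simpa using (h.shift_add hq k).hold_zero_pos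

theorem IsJumpHold.hold_zero_lt_top (h : IsJumpHold q Y T P) :
    ∀ᵐ ω ∂P, exitRate q (Y 0 ω) ≤ 0 ∨ T 0 ω < ∞ := by
  have key : ∀ a, 0 < exitRate q a → P {ω | Y 0 ω = a ∧ T 0 ω = ∞} = 0 := by
    intro a ha
    have h1 : ∀ n : ℕ, P {ω | Y 0 ω = a ∧ T 0 ω = ∞} ≤
        P {ω | Y 0 ω = a} * ENNReal.ofReal (Real.exp (-(exitRate q a * n))) := by
      intro n
      have := h.law_zero a n
      rw [NNReal.coe_natCast] at this
      rw [← this]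
      refine measure_mono fun ω hω => ⟨hω.1, ?_⟩
      rw [hω.2]
      exact ENNReal.coe_lt_top
    have h2 : Filter.Tendsto (fun n : ℕ => P {ω | Y 0 ω = a} *
        ENNReal.ofReal (Real.exp (-(exitRate q a * n)))) Filter.atTop
        (nhds (P {ω | Y 0 ω = a} * ENNReal.ofReal 0)) := by
      refine ENNReal.Tendsto.const_mul (ENNReal.tendsto_ofReal ?_) (Or.inr (measure_ne_top _ _))
      exact Real.tendsto_exp_neg_atTop_nhds_zero.comp
        (tendsto_natCast_atTop_atTop.const_mul_atTop ha)
    rw [ENNReal.ofReal_zero, mul_zero] at h2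
    exact le_antisymm (ge_of_tendsto' h2 h1) zero_le
  have key' : ∀ᵐ ω ∂P, ∀ a, ¬ (0 < exitRate q a ∧ Y 0 ω = a ∧ T 0 ω = ∞) := by
    refine ae_all_iff.2 fun a => ?_
    by_cases ha : 0 < exitRate q a
    · rw [ae_iff]
      simpa [ha] using key a ha
    · simp [ha]
  filter_upwards [key'] with ω hω
  by_contra! h1
  exact hω (Y 0 ω) ⟨h1.1, rfl, top_le_iff.1 h1.2⟩

theorem IsJumpHold.hold_lt_top (hq : IsQMatrix q) (h : IsJumpHold q Y T P) :
    ∀ᵐ ω ∂P, ∀ k, exitRate q (Y k ω) ≤ 0 ∨ T k ω < ∞ :=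
  ae_all_iff.2 fun k => by simpa using (h.shift_add hq k).hold_zero_lt_top

theorem IsJumpHold.hold_zero_eq_top (h : IsJumpHold q Y T P) {a : E} (ha : exitRate q a = 0) :
    ∀ᵐ ω ∂P, Y 0 ω = a → T 0 ω = ∞ := by
  have key : ∀ n : ℕ, ∀ᵐ ω ∂P, ω ∈ {ω | Y 0 ω = a ∧ ((n : ℝ≥0) : ℝ≥0∞) < T 0 ω} ↔
      ω ∈ {ω | Y 0 ω = a} := by
    intro n
    refine Filter.EventuallyEq.mem_iff (ae_eq_of_subset_of_measure_ge (fun ω hω => hω.1) ?_ ?_ ?_)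
    · rw [h.law_zero, ha]; simp
    · exact ((h.measurable_state 0 (measurableSet_singleton a)).inter
        (h.measurable_hold 0 measurableSet_Ioi)).nullMeasurableSet
    · exact measure_ne_top _ _
  filter_upwards [ae_all_iff.2 key] with ω hω h1
  by_contra h2
  obtain ⟨n, hn⟩ := ENNReal.exists_nat_gt h2
  have := ((hω n).2 h1).2
  simp only [ENNReal.coe_natCast] at this
  exact lt_asymm hn this

end JumpHold

/-! ### The law of states and holding times is determined by `q` and the initial distribution. -/

section Uniqueness

variable {E : Type*} [MeasurableSpace E] [Countable E] [MeasurableSingletonClass E]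

/-- The half-lines and the whole line, as constraints on a holding time. -/
def holdSets : Set (Set ℝ≥0∞) := insert Set.univ (Set.range fun t : ℝ≥0 => Set.Ioi (t : ℝ≥0∞))

theorem inter_mem_holdSets {A B : Set ℝ≥0∞} (hA : A ∈ holdSets) (hB : B ∈ holdSets) :
    A ∩ B ∈ holdSets := by
  rcases hA with rfl | ⟨s, rfl⟩
  · simpa using hB
  · rcases hB with rfl | ⟨t, rfl⟩
    · rw [Set.inter_univ]
      exact Or.inr ⟨s, rfl⟩
    · refine Or.inr ⟨s ⊔ t, ?_⟩
      simp only [Set.Ioi_inter_Ioi, ENNReal.coe_max]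

theorem measurableSet_of_mem_holdSets {A : Set ℝ≥0∞} (hA : A ∈ holdSets) : MeasurableSet A := by
  rcases hA with rfl | ⟨s, rfl⟩
  · exact .univ
  · exact measurableSet_Ioi

/-- For positive holding times, hence almost surely, the whole line is the same constraint as `Ioi
0`. It is still needed as a generator: otherwise the states of sequences with zero holding times
would not be seen. -/
theorem exists_Ioi_of_mem_holdSets {A : Set ℝ≥0∞} (hA : A ∈ holdSets) :
    ∃ t : ℝ≥0, ∀ s, 0 < s → (s ∈ A ↔ (t : ℝ≥0∞) < s) := by
  rcases hA with rfl | ⟨t, rfl⟩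
  · exact ⟨0, fun s hs => by simpa using hs⟩
  · exact ⟨t, fun s _ => Iff.rfl⟩

/-- A cylinder set of sequences of states and holding times. -/
def jumpHoldCylinder (n : ℕ) (i : ℕ → E) (V : ℕ → Set ℝ≥0∞) : Set (ℕ → E × ℝ≥0∞) :=
  {z | ∀ k ≤ n, (z k).1 = i k ∧ (z k).2 ∈ V k}

/-- The cylinder sets that determine the law of a chain with its holding times. -/
def jumpHoldCylinders (E : Type*) : Set (Set (ℕ → E × ℝ≥0∞)) :=
  {s | ∃ (n : ℕ) (i : ℕ → E) (V : ℕ → Set ℝ≥0∞), (∀ k, V k ∈ holdSets) ∧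
    s = jumpHoldCylinder n i V}

theorem isPiSystem_jumpHoldCylinders : IsPiSystem (jumpHoldCylinders E) := by
  rintro _ ⟨n, i, V, hV, rfl⟩ _ ⟨n', i', V', hV', rfl⟩ ⟨z, hz, hz'⟩
  -- A common point `z` of the two cylinders carries both prescribed sequences of states.
  refine ⟨max n n', fun k => (z k).1,
    fun k => (if k ≤ n then V k else Set.univ) ∩ (if k ≤ n' then V' k else Set.univ), ?_, ?_⟩
  · intro k
    refine inter_mem_holdSets ?_ ?_ <;> split_ifs
    · exact hV k
    · exact Or.inl rfl
    · exact hV' k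
    · exact Or.inl rfl
  · ext w
    constructor
    · rintro ⟨h1, h2⟩ k hk
      refine ⟨?_, ?_, ?_⟩
      · rcases le_max_iff.1 hk with h | h
        · exact (h1 k h).1.trans (hz k h).1.symm
        · exact (h2 k h).1.trans (hz' k h).1.symm
      · split_ifs with h
        · exact (h1 k h).2
        · trivial
      · split_ifs with h
        · exact (h2 k h).2
        · trivial
    · intro h
      refine ⟨fun k hk => ?_, fun k hk => ?_⟩
      · obtain ⟨h1, h2, -⟩ := h k (hk.trans (le_max_left _ _))
        rw [if_pos hk] at h2
        exact ⟨h1.trans (hz k hk).1, h2⟩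
      · obtain ⟨h1, -, h2⟩ := h k (hk.trans (le_max_right _ _))
        rw [if_pos hk] at h2
        exact ⟨h1.trans (hz' k hk).1, h2⟩

theorem measurableSet_jumpHoldCylinder (n : ℕ) (i : ℕ → E) {V : ℕ → Set ℝ≥0∞}
    (hV : ∀ k, V k ∈ holdSets) : MeasurableSet (jumpHoldCylinder n i V) := by
  have : jumpHoldCylinder n i V =
      ⋂ k, ⋂ (_ : k ≤ n), (fun z : ℕ → E × ℝ≥0∞ => z k) ⁻¹' ({i k} ×ˢ V k) := by
    ext z; simp [jumpHoldCylinder]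
  rw [this]
  exact MeasurableSet.iInter fun k => MeasurableSet.iInter fun _ => measurable_pi_apply k
    ((measurableSet_singleton _).prod (measurableSet_of_mem_holdSets (hV k)))

theorem generateFrom_jumpHoldCylinders :
    (MeasurableSpace.pi : MeasurableSpace (ℕ → E × ℝ≥0∞)) =
      MeasurableSpace.generateFrom (jumpHoldCylinders E) := by
  refine le_antisymm ?_ (MeasurableSpace.generateFrom_le ?_)
  · have key : ∀ (k : ℕ) (e : E) (V : Set ℝ≥0∞), V ∈ holdSets →
        MeasurableSet[MeasurableSpace.generateFrom (jumpHoldCylinders E)]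
          {z | (z k).1 = e ∧ (z k).2 ∈ V} := by
      intro k e V hV
      -- A condition on the index `k` alone is a union over the possible finite prefixes, of which
      -- there are countably many.
      have h1 : {z : ℕ → E × ℝ≥0∞ | (z k).1 = e ∧ (z k).2 ∈ V} =
          ⋃ j : Fin k → E, jumpHoldCylinder k (fun m => if h : m < k then j ⟨m, h⟩ else e)
            (fun m => if m = k then V else Set.univ) := by
        ext z
        simp only [Set.mem_ofPred_eq, Set.mem_iUnion, jumpHoldCylinder]
        constructor
        · rintro ⟨h1, h2⟩
          refine ⟨fun m => (z m).1, fun m hm => ?_⟩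
          rcases hm.lt_or_eq with h | rfl
          · simp [h, h.ne]
          · simpa using ⟨h1, h2⟩
        · rintro ⟨j, hj⟩
          simpa using hj k le_rfl
      rw [h1]
      refine MeasurableSet.iUnion fun j => MeasurableSpace.measurableSet_generateFrom
        ⟨k, _, _, fun m => ?_, rfl⟩
      split_ifs
      · exact hV
      · exact Or.inl rfl
    refine iSup_le fun k => ?_
    rw [← measurable_iff_comap_le]
    let _ : MeasurableSpace (ℕ → E × ℝ≥0∞) := MeasurableSpace.generateFrom (jumpHoldCylinders E)
    refine Measurable.prodMk (f := fun z : ℕ → E × ℝ≥0∞ => (z k).1)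
      (g := fun z : ℕ → E × ℝ≥0∞ => (z k).2) ?_ ?_
    · refine measurable_to_countable' fun e => ?_
      have := key k e Set.univ (Or.inl rfl)
      simpa [Set.preimage] using this
    · refine measurable_of_Ioi fun x => ?_
      have : (fun z : ℕ → E × ℝ≥0∞ => (z k).2) ⁻¹' Set.Ioi x =
          ⋃ e : E, {z | (z k).1 = e ∧ (z k).2 ∈ Set.Ioi x} := by
        ext z; simp
      rw [this]
      refine MeasurableSet.iUnion fun e => ?_
      by_cases hx : x = ∞
      · simp [hx]
      · lift x to ℝ≥0 using hx
        exact key k e _ (Or.inr ⟨x, rfl⟩)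
  · rintro _ ⟨n, i, V, hV, rfl⟩
    exact measurableSet_jumpHoldCylinder n i hV

variable {q : E → E → ℝ} {Ω Ω' : Type*} [MeasurableSpace Ω] [MeasurableSpace Ω'] {P : Measure Ω}
  {P' : Measure Ω'} [IsFiniteMeasure P] [IsFiniteMeasure P']
  {Y : ℕ → Ω → E} {T : ℕ → Ω → ℝ≥0∞} {Y' : ℕ → Ω' → E} {T' : ℕ → Ω' → ℝ≥0∞}

theorem IsJumpHold.measurable_prodMk (h : IsJumpHold q Y T P) :
    Measurable fun ω k => (Y k ω, T k ω) :=
  measurable_pi_lambda _ fun k => (h.measurable_state k).prodMk (h.measurable_hold k)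

theorem IsJumpHold.map_jumpHoldCylinder (hq : IsQMatrix q) (h : IsJumpHold q Y T P) (n : ℕ)
    (i : ℕ → E) {V : ℕ → Set ℝ≥0∞} (hV : ∀ k, V k ∈ holdSets) {t : ℕ → ℝ≥0}
    (ht : ∀ k, ∀ s, 0 < s → (s ∈ V k ↔ (t k : ℝ≥0∞) < s)) :
    P.map (fun ω k => (Y k ω, T k ω)) (jumpHoldCylinder n i V) =
      P {ω | Y 0 ω = i 0} * pathWeight q n i t := by
  rw [Measure.map_apply h.measurable_prodMk (measurableSet_jumpHoldCylinder n i hV),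
    ← h.law_pathWeight]
  refine measure_congr (Filter.eventuallyEq_set.2 ?_)
  filter_upwards [h.hold_pos hq] with ω hω
  exact forall₂_congr fun k _ => and_congr_right fun _ => ht k _ (hω k)

/-- The initial distribution and the `Q`-matrix determine the law of the states and the holding
times. -/
theorem IsJumpHold.map_eq (hq : IsQMatrix q) (h : IsJumpHold q Y T P) (h' : IsJumpHold q Y' T' P')
    (h0 : ∀ i, P {ω | Y 0 ω = i} = P' {ω | Y' 0 ω = i}) :
    P.map (fun ω k => (Y k ω, T k ω)) = P'.map (fun ω k => (Y' k ω, T' k ω)) := by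
  have := Measure.isFiniteMeasure_map P (fun ω k => (Y k ω, T k ω))
  refine ext_of_generate_finite _ generateFrom_jumpHoldCylinders isPiSystem_jumpHoldCylinders ?_ ?_
  · rintro _ ⟨n, i, V, hV, rfl⟩
    choose t ht using fun k => exists_Ioi_of_mem_holdSets (hV k)
    rw [h.map_jumpHoldCylinder hq n i hV ht, h'.map_jumpHoldCylinder hq n i hV ht, h0]
  · rw [Measure.map_apply h.measurable_prodMk .univ, Measure.map_apply h'.measurable_prodMk .univ]
    have h1 := tsum_measure_and_eq (P := P) (p := fun _ => True) (h.measurable_state 0) (by simp)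
    have h2 := tsum_measure_and_eq (P := P') (p := fun _ => True) (h'.measurable_state 0) (by simp)
    simp only [true_and, Set.ofPred_true] at h1 h2
    rw [Set.preimage_univ, Set.preimage_univ, ← h1, ← h2]
    exact tsum_congr h0

end Uniqueness

/-! ### Avoidance probabilities of a discrete chain, and recurrence. -/

section Avoid

variable {E : Type*}

/-- The probability that a discrete chain with transition matrix `r` avoids `D` up to time `n`. -/
noncomputable def avoidProb (r : E → E → ℝ≥0∞) (D : Set E) : ℕ → E → ℝ≥0∞
  | 0, a => if a ∈ D then 0 else 1
  | n + 1, a => if a ∈ D then 0 else ∑' b, r a b * avoidProb r D n b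

theorem avoidProb_le_one {r : E → E → ℝ≥0∞} (hr : ∀ a, ∑' b, r a b = 1) (D : Set E) (n : ℕ) :
    ∀ a, avoidProb r D n a ≤ 1 := by
  induction n with
  | zero => intro a; rw [avoidProb]; split_ifs <;> simp
  | succ n ih =>
    intro a
    rw [avoidProb]
    split_ifs
    · simp
    · calc ∑' b, r a b * avoidProb r D n b ≤ ∑' b, r a b * 1 :=
            ENNReal.tsum_le_tsum fun b => mul_le_mul_right (ih b) _
        _ = 1 := by simp [hr]

theorem avoidProb_succ_le {r : E → E → ℝ≥0∞} (hr : ∀ a, ∑' b, r a b = 1) (D : Set E) (n : ℕ) :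
    ∀ a, avoidProb r D (n + 1) a ≤ avoidProb r D n a := by
  induction n with
  | zero =>
    intro a
    by_cases ha : a ∈ D
    · simp [avoidProb, ha]
    · rw [avoidProb.eq_def r D 0]
      simpa [ha] using avoidProb_le_one hr D 1 a
  | succ n ih =>
    intro a
    rw [avoidProb, avoidProb.eq_def r D (n + 1)]
    simp only
    split_ifs
    · exact le_rfl
    · exact ENNReal.tsum_le_tsum fun b => mul_le_mul_right (ih b) _

/-- In an irreducible chain, if a state is recurrent then it is reached from everywhere. -/
theorem iInf_avoidProb_eq_zero {r : E → E → ℝ≥0∞} (hr : ∀ a, ∑' b, r a b = 1) {y : E}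
    (hy : ∀ ε, 0 < ε → ∃ n, ∑' b, r y b * avoidProb r {y} n b ≤ ε) {z : E}
    (hz : Relation.ReflTransGen (fun a b => 0 < r a b) y z) :
    ⨅ n, avoidProb r {y} n z = 0 := by
  have hle : ∀ a n, ∑' b, r a b * ⨅ n, avoidProb r {y} n b ≤
      ∑' b, r a b * avoidProb r {y} n b := fun a n =>
    ENNReal.tsum_le_tsum fun b => mul_le_mul_right (iInf_le _ n) _
  have hsum : ∀ a, (∑' b, r a b * ⨅ n, avoidProb r {y} n b) = 0 → ∀ b, 0 < r a b →
      ⨅ n, avoidProb r {y} n b = 0 := by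
    intro a ha b hb
    have := ENNReal.tsum_eq_zero.1 ha b
    exact (mul_eq_zero.1 this).resolve_left hb.ne'
  induction hz with
  | refl =>
    refine le_antisymm ((iInf_le _ 0).trans ?_) zero_le
    simp [avoidProb]
  | @tail a b _ hab ih =>
    refine hsum a (le_antisymm (le_of_forall_pos_le_add fun ε hε => ?_) zero_le) b hab
    rw [zero_add]
    -- At `y` the recursion for `avoidProb` returns `0` and says nothing about the successors, so
    -- the recurrence hypothesis is used; elsewhere the sum over the successors is the avoidance
    -- probability of `a` itself, one step later.
    by_cases ha : a = y
    · subst ha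
      obtain ⟨n, hn⟩ := hy ε hε
      exact (hle a n).trans hn
    · have h1 : ⨅ n, avoidProb r {y} n a < ε := by rwa [ih]
      obtain ⟨n, hn⟩ := iInf_lt_iff.1 h1
      refine (hle a n).trans (le_trans ?_ ((avoidProb_succ_le hr _ n a).trans hn.le))
      rw [avoidProb, if_neg (by simpa using ha)]

end Avoid

/-- The transition probabilities of the jump chain, as extended nonnegative reals. -/
noncomputable def jumpProb {E : Type*} (q : E → E → ℝ) (a b : E) : ℝ≥0∞ :=
  ENNReal.ofReal (jumpMatrix q a b)

section JumpProb

variable {E : Type*} {q : E → E → ℝ}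

theorem tsum_prod_eq (f : E × E → ℝ≥0∞) : ∑' p, f p = ∑' a, ∑' b, f (a, b) :=
  ENNReal.tsum_prod (f := fun a b => f (a, b))

theorem tsum_jumpProb (hq : IsQMatrix q) (x : E) : ∑' y, jumpProb q x y = 1 :=
  tsum_ofReal_jumpMatrix hq x

theorem jumpProb_pos (hq : IsQMatrix q) {x y : E} (hxy : x ≠ y) (h : 0 < q x y) :
    0 < jumpProb q x y := by
  have hs : Summable (fun y : {y : E // y ≠ x} => q x y) := (hq.hasSum_row x).summable.subtype _
  have h1 := hs.le_tsum ⟨y, hxy.symm⟩ fun y _ => hq.nonneg x y y.2.symm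
  have h2 : 0 < exitRate q x := h.trans_le h1
  rw [jumpProb, ENNReal.ofReal_pos, jumpMatrix, if_neg h2.ne', if_neg hxy.symm]
  exact div_pos h h2

theorem reflTransGen_jumpProb (hq : IsQMatrix q) (hirr : IsIrreducible q) (x y : E) :
    Relation.ReflTransGen (fun a b => 0 < jumpProb q a b) x y :=
  Relation.ReflTransGen.mono (r := fun a b => a ≠ b ∧ 0 < q a b)
    (fun _ _ h => jumpProb_pos hq h.1 h.2) x y (hirr x y)

theorem jumpProb_catMouseMatrix_diag (hq : IsQMatrix q) (x : E) (b : E × E) :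
    jumpProb (catMouseMatrix q) (x, x) b = jumpProb q x b.1 * jumpProb q x b.2 := by
  rw [jumpProb, jumpMatrix_catMouseMatrix_diag hq, ENNReal.ofReal_mul (jumpMatrix_nonneg hq _ _)]
  rfl

theorem jumpProb_catMouseMatrix_of_ne (hq : IsQMatrix q) {x y : E} (h : x ≠ y) (b : E × E) :
    jumpProb (catMouseMatrix q) (x, y) b = if b.2 = y then jumpProb q x b.1 else 0 := by
  rw [jumpProb, jumpMatrix_catMouseMatrix_of_ne hq h]
  split_ifs <;> simp [jumpProb]

/-- The cat moves according to the jump matrix of `q`. -/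
theorem tsum_jumpProb_catMouseMatrix_fst (hq : IsQMatrix q) (a : E × E) (z : E) :
    ∑' b, Set.indicator {b : E × E | b.1 = z} (jumpProb (catMouseMatrix q) a) b =
      jumpProb q a.1 z := by
  obtain ⟨x, y⟩ := a
  rw [tsum_prod_eq, tsum_eq_single z]
  · by_cases h : x = y
    · subst h
      simp [Set.indicator, jumpProb_catMouseMatrix_diag hq, ENNReal.tsum_mul_left,
        tsum_jumpProb hq]
    · simp [Set.indicator, jumpProb_catMouseMatrix_of_ne hq h]
  · intro w hw
    simp [Set.indicator, hw]

/-- When they are together, the mouse moves according to the jump matrix of `q`. -/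
theorem tsum_jumpProb_catMouseMatrix_snd (hq : IsQMatrix q) (x : E) (z : E) :
    ∑' b, Set.indicator {b : E × E | b.2 = z} (jumpProb (catMouseMatrix q) (x, x)) b =
      jumpProb q x z := by
  rw [tsum_prod_eq, ENNReal.tsum_comm, tsum_eq_single z]
  · simp [Set.indicator, jumpProb_catMouseMatrix_diag hq, ENNReal.tsum_mul_right,
        tsum_jumpProb hq]
  · intro w hw
    simp [Set.indicator, hw]

/-- Until they meet, the cat moves according to the jump matrix of `q` and the mouse does not. -/
theorem avoidProb_catMouseMatrix (hq : IsQMatrix q) (n : ℕ) : ∀ x y : E,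
    avoidProb (jumpProb (catMouseMatrix q)) {b | b.1 = b.2} n (x, y) =
      avoidProb (jumpProb q) {y} n x := by
  induction n with
  | zero => intro x y; simp [avoidProb]
  | succ n ih =>
    intro x y
    by_cases h : x = y
    · simp [avoidProb, h]
    · simp only [avoidProb, Set.mem_ofPred_eq, Set.mem_singleton_iff, h, if_false]
      rw [tsum_prod_eq]
      refine tsum_congr fun z => ?_
      rw [tsum_eq_single y]
      · rw [ih, jumpProb_catMouseMatrix_of_ne hq h, if_pos rfl]
      · intro w hw
        rw [jumpProb_catMouseMatrix_of_ne hq h, if_neg hw, zero_mul]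

end JumpProb

section Transitions

variable {E : Type*} [MeasurableSpace E] [Countable E] [MeasurableSingletonClass E]
  {Ω : Type*} [MeasurableSpace Ω] {q : E → E → ℝ}

theorem IsJumpHold.law_step_mem {P : Measure Ω} [IsFiniteMeasure P] {Y : ℕ → Ω → E}
    {T : ℕ → Ω → ℝ≥0∞} (hq : IsQMatrix q) (h : IsJumpHold q Y T P) (a : E) (t : ℝ≥0)
    (D : Set E) :
    P {ω | (Y 0 ω = a ∧ (t : ℝ≥0∞) < T 0 ω) ∧ Y 1 ω ∈ D} =
      P {ω | Y 0 ω = a} * ENNReal.ofReal (Real.exp (-(exitRate q a * t))) *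
        ∑' b, D.indicator (jumpProb q a) b := by
  have hB : MeasurableSet {ω | Y 0 ω = a ∧ (t : ℝ≥0∞) < T 0 ω} :=
    (h.measurableSet_eq 0 a).inter (h.measurable_hold 0 measurableSet_Ioi)
  have hB' : MeasurableSet {ω | (Y 0 ω = a ∧ (t : ℝ≥0∞) < T 0 ω) ∧ Y 1 ω ∈ D} :=
    hB.inter (h.measurableSet_state 1 D)
  rw [← tsum_measure_and_eq (h.measurable_state 1) hB',
    ← ENNReal.tsum_mul_left]
  refine tsum_congr fun b => ?_
  by_cases hb : b ∈ D
  · rw [Set.indicator_of_mem hb, jumpProb, ← h.law_step hq]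
    congr 1
    ext ω
    constructor
    · rintro ⟨⟨h1, -⟩, h2⟩
      exact ⟨h1, h2⟩
    · rintro ⟨h1, h2⟩
      exact ⟨⟨h1, by rw [h2]; exact hb⟩, h2⟩
  · rw [Set.indicator_of_notMem hb, mul_zero]
    convert measure_empty (μ := P)
    refine Set.eq_empty_iff_forall_notMem.2 fun ω hω => hb ?_
    rw [← hω.2]
    exact hω.1.2

theorem IsJumpHold.law_transition {P : Measure Ω} [IsFiniteMeasure P] {Y : ℕ → Ω → E}
    {T : ℕ → Ω → ℝ≥0∞} (hq : IsQMatrix q) (h : IsJumpHold q Y T P) (a b : E) :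
    P {ω | Y 0 ω = a ∧ Y 1 ω = b} = P {ω | Y 0 ω = a} * jumpProb q a b := by
  have h1 := h.law_step hq a b 0
  simp only [NNReal.coe_zero, mul_zero, neg_zero, Real.exp_zero, ENNReal.ofReal_one,
    mul_one] at h1
  refine Eq.trans (measure_congr (Filter.eventuallyEq_set.2 ?_)) h1
  filter_upwards [h.hold_zero_pos] with ω hω
  exact and_congr_left fun _ => ⟨fun h2 => ⟨h2, hω⟩, fun h2 => h2.1⟩

/-- Induction by conditioning on the first step. The measure and the chain are quantified inside,
because the induction hypothesis is applied to the shifted chain under the measure restricted to `Y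
0 = a`. -/
theorem IsJumpHold.measure_avoid (hq : IsQMatrix q) (D : Set E) (n : ℕ) :
    ∀ {P : Measure Ω} [IsFiniteMeasure P] {Y : ℕ → Ω → E} {T : ℕ → Ω → ℝ≥0∞},
      IsJumpHold q Y T P → ∀ a, P {ω | Y 0 ω = a ∧ ∀ k ≤ n, Y k ω ∉ D} =
        P {ω | Y 0 ω = a} * avoidProb (jumpProb q) D n a := by
  have hm : ∀ {P : Measure Ω} {Y : ℕ → Ω → E} {T : ℕ → Ω → ℝ≥0∞},
      IsJumpHold q Y T P → ∀ n, MeasurableSet {ω | ∀ k ≤ n, Y k ω ∉ D} := by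
    intro P Y T h n
    have : {ω | ∀ k ≤ n, Y k ω ∉ D} = ⋂ k, ⋂ (_ : k ≤ n), {ω | Y k ω ∈ Dᶜ} := by
      ext ω; simp
    rw [this]
    exact MeasurableSet.iInter fun k => MeasurableSet.iInter fun _ => h.measurableSet_state k _
  have h0 : ∀ {P : Measure Ω} {Y : ℕ → Ω → E} (n : ℕ) (a : E), a ∈ D →
      P {ω | Y 0 ω = a ∧ ∀ k ≤ n, Y k ω ∉ D} = 0 := by
    intro P Y n a ha
    convert measure_empty (μ := P)
    refine Set.eq_empty_iff_forall_notMem.2 fun ω hω => hω.2 0 n.zero_le ?_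
    rw [hω.1]
    exact ha
  induction n with
  | zero =>
    intro P _ Y T h a
    by_cases ha : a ∈ D
    · rw [h0 0 a ha, avoidProb, if_pos ha, mul_zero]
    · rw [avoidProb, if_neg ha, mul_one]
      congr 1
      ext ω
      refine and_iff_left_of_imp fun h1 k hk => ?_
      rw [Nat.le_zero.1 hk, show Y 0 ω = a from h1]
      exact ha
  | succ n ih =>
    intro P _ Y T h a
    by_cases ha : a ∈ D
    · rw [h0 (n + 1) a ha, avoidProb, if_pos ha, mul_zero]
    · have h4 : MeasurableSet {ω | Y 0 ω = a ∧ ∀ k ≤ n + 1, Y k ω ∉ D} :=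
        (h.measurableSet_eq 0 a).inter (hm h (n + 1))
      have h5 : ∀ b, MeasurableSet {ω | Y (0 + 1) ω = b ∧ ∀ k ≤ n, Y (k + 1) ω ∉ D} := fun b =>
        (h.measurableSet_eq 1 b).inter (hm (h.shift hq) n)
      rw [avoidProb, if_neg ha, ← tsum_measure_and_eq (h.measurable_state 1) h4, ← ENNReal.tsum_mul_left]
      refine tsum_congr fun b => ?_
      have h1 := ih (h.shift_restrict_mem hq {a}) b
      rw [Measure.restrict_apply (h5 b),
        Measure.restrict_apply (h.measurableSet_eq 1 b)] at h1
      rw [← mul_assoc, ← h.law_transition hq]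
      have h2 : {ω | Y 0 ω = a ∧ Y 1 ω = b} = {ω | Y 1 ω = b} ∩ {ω | Y 0 ω ∈ ({a} : Set E)} :=
        Set.inter_comm _ _
      rw [h2]
      refine Eq.trans ?_ h1
      congr 1
      ext ω
      constructor
      · rintro ⟨⟨h3, h4⟩, h5⟩
        exact ⟨⟨h5, fun k hk => h4 (k + 1) (by omega)⟩, h3⟩
      · rintro ⟨⟨h5, h4⟩, h3⟩
        refine ⟨⟨h3, fun k hk => ?_⟩, h5⟩
        cases k with
        | zero => rw [show Y 0 ω = a from h3]; exact ha
        | succ k => exact h4 k (by omega)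

/-- If `D` cannot be avoided, then almost surely it is visited infinitely often. -/
theorem IsJumpHold.ae_frequently_mem {P : Measure Ω} [IsFiniteMeasure P] {Y : ℕ → Ω → E}
    {T : ℕ → Ω → ℝ≥0∞} (hq : IsQMatrix q) (h : IsJumpHold q Y T P) {D : Set E}
    (hD : ∀ a, ⨅ n, avoidProb (jumpProb q) D n a = 0) :
    ∀ᵐ ω ∂P, ∀ N, ∃ k, Y (k + N) ω ∈ D := by
  have key : ∀ {Y : ℕ → Ω → E} {T : ℕ → Ω → ℝ≥0∞}, IsJumpHold q Y T P →
      ∀ᵐ ω ∂P, ∃ k, Y k ω ∈ D := by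
    intro Y T h
    have h1 : ∀ a, ∀ᵐ ω ∂P, ¬ (Y 0 ω = a ∧ ∀ k, Y k ω ∉ D) := by
      intro a
      rw [ae_iff]
      simp only [not_not]
      refine le_antisymm ?_ zero_le
      calc P {ω | Y 0 ω = a ∧ ∀ k, Y k ω ∉ D}
          ≤ ⨅ n, P {ω | Y 0 ω = a} * avoidProb (jumpProb q) D n a := by
            refine le_iInf fun n => ?_
            rw [← h.measure_avoid hq]
            exact measure_mono fun ω hω => ⟨hω.1, fun k _ => hω.2 k⟩
        _ = 0 := by
            rw [← ENNReal.mul_iInf fun h2 => absurd h2 (measure_ne_top _ _), hD, mul_zero]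
    filter_upwards [ae_all_iff.2 h1] with ω hω
    by_contra! h2
    exact hω _ ⟨rfl, h2⟩
  exact ae_all_iff.2 fun N => key (h.shift_add hq N)

end Transitions

/-! ### The cat alone. -/

section Cat

variable {E : Type*} [MeasurableSpace E] [Countable E] [MeasurableSingletonClass E]
  {Ω : Type*} [MeasurableSpace Ω] {q : E → E → ℝ}

/-- The cat is a jump chain with `Q`-matrix `q`. -/
theorem IsJumpHold.cat {P : Measure Ω} [IsFiniteMeasure P] {Y : ℕ → Ω → E × E}
    {T : ℕ → Ω → ℝ≥0∞} (hq : IsQMatrix q) (h : IsJumpHold (catMouseMatrix q) Y T P) :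
    IsJumpHold q (fun k ω => (Y k ω).1) T P := by
  have hcm := isQMatrix_catMouseMatrix hq
  refine isJumpHold_of_law_pathWeight (fun n => measurable_fst.comp (h.measurable_state n))
    h.measurable_hold fun n => ?_
  induction n generalizing P Y T with
  | zero =>
    intro i t
    simp only [Nat.le_zero, forall_eq, pathWeight_zero]
    have h1 : MeasurableSet {ω | (Y 0 ω).1 = i 0} := h.measurableSet_state 0 {a | a.1 = i 0}
    have h2 : MeasurableSet {ω | (Y 0 ω).1 = i 0 ∧ (t 0 : ℝ≥0∞) < T 0 ω} :=
      h1.inter (h.measurable_hold 0 measurableSet_Ioi)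
    rw [← tsum_measure_and_eq (h.measurable_state 0) h1,
      ← tsum_measure_and_eq (h.measurable_state 0) h2, ← ENNReal.tsum_mul_right]
    refine tsum_congr fun a => ?_
    by_cases ha : a.1 = i 0
    · have h3 := h.law_zero a (t 0)
      rw [exitRate_catMouseMatrix hq, ha] at h3
      convert h3 using 2
      · ext ω
        exact ⟨fun h => ⟨h.2, h.1.2⟩, fun h => ⟨⟨by rw [h.1, ha], h.2⟩, h.1⟩⟩
      · congr 1
        ext ω
        exact ⟨fun h => h.2, fun h => ⟨by rw [show Y 0 ω = a from h, ha], h⟩⟩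
    · have h3 : {ω | (Y 0 ω).1 = i 0 ∧ Y 0 ω = a} = ∅ :=
        Set.eq_empty_iff_forall_notMem.2 fun ω hω => ha (by rw [← hω.2, hω.1])
      have h4 : {ω | ((Y 0 ω).1 = i 0 ∧ (t 0 : ℝ≥0∞) < T 0 ω) ∧ Y 0 ω = a} = ∅ :=
        Set.eq_empty_iff_forall_notMem.2 fun ω hω => ha (by rw [← hω.2, hω.1.1])
      rw [h3, h4]
      simp
  | succ n ih =>
    intro i t
    have hY : ∀ n, Measurable fun ω => (Y n ω).1 :=
      fun n => measurable_fst.comp (h.measurable_state n)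
    have h1 : MeasurableSet {ω | (Y 0 ω).1 = i 0} := h.measurableSet_state 0 {a | a.1 = i 0}
    -- Split according to the whole pair `Y 0`: the exit rate and the law of the cat's next position
    -- do not depend on the mouse, so all fibres carry the same factor.
    rw [← tsum_measure_and_eq (h.measurable_state 0) h1,
      ← tsum_measure_and_eq (h.measurable_state 0)
        (measurableSet_cylinder hY h.measurable_hold (n + 1) i t), ← ENNReal.tsum_mul_right]
    refine tsum_congr fun a => ?_
    by_cases ha : a.1 = i 0
    · have h7 : MeasurableSet {ω | (Y (0 + 1) ω).1 = i (0 + 1)} :=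
        h.measurableSet_state 1 {a | a.1 = i 1}
      have h2 := ih (h.shift_restrict_lt hcm a (t 0)) (fun k => i (k + 1)) (fun k => t (k + 1))
      rw [Measure.restrict_apply (measurableSet_cylinder (fun n => hY (n + 1))
        (fun n => h.measurable_hold (n + 1)) n _ _),
        Measure.restrict_apply h7] at h2
      have h3 := h.law_step_mem hcm a (t 0) {b | b.1 = i 1}
      rw [tsum_jumpProb_catMouseMatrix_fst hq, exitRate_catMouseMatrix hq, ha] at h3
      have h4 : {ω | (Y (0 + 1) ω).1 = i (0 + 1)} ∩ {ω | Y 0 ω = a ∧ (t 0 : ℝ≥0∞) < T 0 ω} =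
          {ω | (Y 0 ω = a ∧ (t 0 : ℝ≥0∞) < T 0 ω) ∧ Y 1 ω ∈ {b : E × E | b.1 = i 1}} :=
        Set.inter_comm _ _
      have h5 : {ω | (Y 0 ω).1 = i 0 ∧ Y 0 ω = a} = {ω | Y 0 ω = a} := by
        ext ω
        exact ⟨fun h => h.2, fun h => ⟨by rw [show Y 0 ω = a from h, ha], h⟩⟩
      have h6 : {ω | (∀ k ≤ n + 1, (Y k ω).1 = i k ∧ (t k : ℝ≥0∞) < T k ω) ∧ Y 0 ω = a} =
          {ω | ∀ k ≤ n, (Y (k + 1) ω).1 = i (k + 1) ∧ (t (k + 1) : ℝ≥0∞) < T (k + 1) ω} ∩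
            {ω | Y 0 ω = a ∧ (t 0 : ℝ≥0∞) < T 0 ω} := by
        ext ω
        constructor
        · rintro ⟨h7, h8⟩
          exact ⟨fun k hk => h7 (k + 1) (by omega), h8, (h7 0 (by omega)).2⟩
        · rintro ⟨h7, h8, h9⟩
          refine ⟨fun k hk => ?_, h8⟩
          cases k with
          | zero => exact ⟨by rw [h8, ha], h9⟩
          | succ k => exact h7 k (by omega)
      rw [h6, h5, pathWeight_succ]
      refine h2.trans ?_
      erw [h4, h3]
      simp only [mul_assoc]
      rfl
    · have h3 : {ω | (Y 0 ω).1 = i 0 ∧ Y 0 ω = a} = ∅ :=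
        Set.eq_empty_iff_forall_notMem.2 fun ω hω => ha (by rw [← hω.2, hω.1])
      have h4 : {ω | (∀ k ≤ n + 1, (Y k ω).1 = i k ∧ (t k : ℝ≥0∞) < T k ω) ∧ Y 0 ω = a} = ∅ :=
        Set.eq_empty_iff_forall_notMem.2 fun ω hω =>
          ha (by rw [← hω.2, (hω.1 0 (by omega)).1])
      rw [h3, h4]
      simp

end Cat

/-! ### Consequences of positive recurrence: hitting and non-explosion. -/

section Recurrence

variable {E : Type*} [MeasurableSpace E] [Countable E] [MeasurableSingletonClass E]
  {q : E → E → ℝ}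

theorem exists_sum_range_le_lt {T : ℕ → ℝ≥0∞} (hT : ∑' k, T k = ∞) (t : ℝ≥0) :
    ∃ n, ∑ k ∈ Finset.range n, T k ≤ t ∧ t < ∑ k ∈ Finset.range (n + 1), T k := by
  have h1 : ∃ n, (t : ℝ≥0∞) < ∑ k ∈ Finset.range n, T k := by
    have h2 : (t : ℝ≥0∞) < ∑' k, T k := by rw [hT]; exact ENNReal.coe_lt_top
    rw [ENNReal.tsum_eq_iSup_nat, lt_iSup_iff] at h2
    exact h2
  have h3 : Nat.find h1 ≠ 0 := by
    intro h0
    have := Nat.find_spec h1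
    rw [h0] at this
    simp at this
  obtain ⟨n, hn⟩ := Nat.exists_eq_succ_of_ne_zero h3
  refine ⟨n, not_lt.1 (Nat.find_min h1 (by omega)), ?_⟩
  have := Nat.find_spec h1
  rwa [hn] at this

theorem ae_eq_state_zero {Ω : Type*} [MeasurableSpace Ω] {P : Measure Ω} [IsFiniteMeasure P]
    {X : ℝ≥0 → Ω → E} {Y : ℕ → Ω → E} {T : ℕ → Ω → ℝ≥0∞} (h : IsJumpHold q Y T P)
    (hX : ∀ᵐ ω ∂P, ∑' k, T k ω = ∞ ∧
      ∀ (t : ℝ≥0) (n : ℕ), ∑ k ∈ Finset.range n, T k ω ≤ t →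
        t < ∑ k ∈ Finset.range (n + 1), T k ω → X t ω = Y n ω) :
    ∀ᵐ ω ∂P, X 0 ω = Y 0 ω := by
  filter_upwards [hX, h.hold_zero_pos] with ω h1 h2
  exact h1.2 0 0 (by simp) (by simpa using h2)

/-- If the return time to `y` has finite mean, then the jump chain started at `y` returns to `y`. -/
theorem exists_tsum_avoidProb_le (hq : IsQMatrix q) {Ω : Type*} [MeasurableSpace Ω]
    {P : Measure Ω} [IsProbabilityMeasure P] {X : ℝ≥0 → Ω → E} (hX : IsMarkovChain q X P) {y : E}
    (h0 : ∀ᵐ ω ∂P, X 0 ω = y) (hret : ∫⁻ ω, returnTime X y ω ∂P < ∞) {ε : ℝ≥0∞} (hε : 0 < ε) :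
    ∃ n, ∑' b, jumpProb q y b * avoidProb (jumpProb q) {y} n b ≤ ε := by
  obtain ⟨Y, T, h, hXY⟩ := hX
  have hY0 : ∀ᵐ ω ∂P, Y 0 ω = y := by
    filter_upwards [h0, ae_eq_state_zero h hXY] with ω h1 h2
    rw [← h2, h1]
  have hms : ∀ n, MeasurableSet {ω | ∀ k ≤ n, Y (k + 1) ω ∉ ({y} : Set E)} := by
    intro n
    have : {ω | ∀ k ≤ n, Y (k + 1) ω ∉ ({y} : Set E)} =
        ⋂ k, ⋂ (_ : k ≤ n), {ω | Y (k + 1) ω ∈ ({y}ᶜ : Set E)} := by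
      ext ω; simp
    rw [this]
    exact MeasurableSet.iInter fun k => MeasurableSet.iInter fun _ => h.measurableSet_state _ _
  have hP : ∀ n, ∑' b, jumpProb q y b * avoidProb (jumpProb q) {y} n b =
      P {ω | ∀ k ≤ n, Y (k + 1) ω ∉ ({y} : Set E)} := by
    intro n
    rw [← tsum_measure_and_eq (h.measurable_state 1) (hms n)]
    refine tsum_congr fun b => ?_
    have h1 := (h.shift hq).measure_avoid hq {y} n b
    have h2 : P {ω | Y (0 + 1) ω = b} = jumpProb q y b := by
      have h3 := h.law_transition hq y b
      have h4 : P {ω | Y 0 ω = y} = 1 := prob_compl_eq_zero_iff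
        (h.measurableSet_eq 0 y) |>.1 (mem_ae_iff.1 hY0)
      rw [h4, one_mul] at h3
      rw [← h3]
      refine measure_congr (Filter.eventuallyEq_set.2 ?_)
      filter_upwards [hY0] with ω hω
      exact ⟨fun h => ⟨hω, h⟩, fun h => h.2⟩
    rw [h2] at h1
    rw [← h1]
    congr 1
    ext ω
    exact and_comm
  have hlim : P (⋂ n, {ω | ∀ k ≤ n, Y (k + 1) ω ∉ ({y} : Set E)}) = 0 := by
    set B := ⋂ n, {ω | ∀ k ≤ n, Y (k + 1) ω ∉ ({y} : Set E)} with hB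
    have hBm : MeasurableSet B := MeasurableSet.iInter hms
    -- If the jump chain never comes back, the return time is an infimum over the empty set, hence
    -- `∞`; a finite mean makes this event null.
    have h1 : ∫⁻ ω, B.indicator (fun _ => ∞) ω ∂P ≤ ∫⁻ ω, returnTime X y ω ∂P := by
      refine lintegral_mono_ae ?_
      filter_upwards [hXY, hY0] with ω h2 h3
      refine Set.indicator_apply_le' (fun hω => ?_) fun _ => zero_le
      refine le_iInf₂ fun t ht => absurd ht ?_
      rintro ⟨ht, s, hst, hs⟩
      obtain ⟨m, hm1, hm2⟩ := exists_sum_range_le_lt h2.1 s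
      obtain ⟨n, hn1, hn2⟩ := exists_sum_range_le_lt h2.1 t
      rw [h2.2 s m hm1 hm2] at hs
      rw [h2.2 t n hn1 hn2] at ht
      -- A visit at `t` in a later holding interval contradicts `B`; if `t` lies in the first one,
      -- the earlier time `s` belongs to the initial stay at `y` as well.
      cases n with
      | succ n => exact Set.mem_iInter.1 hω n n le_rfl ht
      | zero =>
        cases m with
        | zero => exact hs h3
        | succ m =>
          have h4 : ∑ k ∈ Finset.range (0 + 1), T k ω ≤ ∑ k ∈ Finset.range (m + 1), T k ω :=
            Finset.sum_le_sum_of_subset (Finset.range_mono (by omega))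
          have h5 := (hn2.trans_le h4).trans_le hm1
          exact lt_asymm hst (by exact_mod_cast h5)
    rw [lintegral_indicator_const hBm] at h1
    by_contra h2
    rw [ENNReal.top_mul h2] at h1
    exact (h1.trans_lt hret).ne rfl
  have hanti : Antitone fun n => {ω | ∀ k ≤ n, Y (k + 1) ω ∉ ({y} : Set E)} :=
    fun m n hmn ω hω k hk => hω k (hk.trans hmn)
  have ht := tendsto_measure_iInter_atTop (μ := P) (fun n => (hms n).nullMeasurableSet) hanti
    ⟨0, measure_ne_top _ _⟩
  rw [hlim] at ht
  obtain ⟨n, hn⟩ := (ht.eventually (ge_mem_nhds hε)).exists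
  exact ⟨n, by rw [hP]; exact hn⟩

theorem iInf_avoidProb_singleton (hq : IsQMatrix q) (hirr : IsIrreducible q)
    (hpos : ∀ x, IsPositiveRecurrentState q x) (y z : E) :
    ⨅ n, avoidProb (jumpProb q) {y} n z = 0 := by
  rcases hpos y with h | ⟨Ω, _, P, X, hP, hX, h0, hret⟩
  · have := subsingleton_of_exitRate_eq_zero hq hirr h
    refine le_antisymm ((iInf_le _ 0).trans ?_) zero_le
    rw [Subsingleton.elim z y]
    simp [avoidProb]
  · exact iInf_avoidProb_eq_zero (tsum_jumpProb hq)
      (fun ε hε => exists_tsum_avoidProb_le hq hX h0 hret hε) (reflTransGen_jumpProb hq hirr y z)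

/-- Until they meet the mouse is a fixed target, which the recurrent cat cannot avoid. -/
theorem iInf_avoidProb_diag (hq : IsQMatrix q) (hirr : IsIrreducible q)
    (hpos : ∀ x, IsPositiveRecurrentState q x) (a : E × E) :
    ⨅ n, avoidProb (jumpProb (catMouseMatrix q)) {b | b.1 = b.2} n a = 0 := by
  obtain ⟨x, y⟩ := a
  simp only [avoidProb_catMouseMatrix hq]
  exact iInf_avoidProb_singleton hq hirr hpos y x

/-- Positive recurrence includes non-explosion. -/
theorem IsJumpHold.tsum_hold_eq_top (hq : IsQMatrix q)
    (hpos : ∀ x, IsPositiveRecurrentState q x) {Ω : Type*} [MeasurableSpace Ω] {P : Measure Ω}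
    [IsFiniteMeasure P] {Y : ℕ → Ω → E} {T : ℕ → Ω → ℝ≥0∞} (h : IsJumpHold q Y T P) :
    ∀ᵐ ω ∂P, ∑' k, T k ω = ∞ := by
  have key : ∀ a, ∀ᵐ ω ∂P, Y 0 ω = a → ∑' k, T k ω = ∞ := by
    intro a
    rcases hpos a with ha | ⟨Ω', _, P', X, hP', ⟨Y', T', h', hXY⟩, h0, -⟩
    · filter_upwards [h.hold_zero_eq_top ha] with ω hω h1
      exact ENNReal.tsum_eq_top_of_eq_top ⟨0, hω h1⟩
    · have hY0 : ∀ᵐ ω ∂P', Y' 0 ω = a := by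
        filter_upwards [h0, ae_eq_state_zero h' hXY] with ω h1 h2
        rw [← h2, h1]
      have hS : MeasurableSet {z : ℕ → E × ℝ≥0∞ | ¬ ∑' k, (z k).2 = ∞} :=
        ((Measurable.tsum fun k => measurable_snd.comp (measurable_pi_apply k))
          (measurableSet_singleton ∞)).compl
      -- The non-explosive chain provided by `hpos a` starts at `a`. Multiplied by the mass of `{Y 0
      -- = a}`, it has the same initial distribution as the restricted chain, so `IsJumpHold.map_eq`
      -- transfers non-explosion.
      have h1 := h.restrict_mem {a}
      have h2 := h'.smul (P {ω | Y 0 ω = a})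
      have hfin : IsFiniteMeasure (P {ω | Y 0 ω = a} • P') :=
        Measure.smul_finite P' (measure_ne_top _ _)
      have h3 := h1.map_eq hq h2 ?_
      · have h4 := congrArg (fun μ => μ {z : ℕ → E × ℝ≥0∞ | ¬ ∑' k, (z k).2 = ∞}) h3
        beta_reduce at h4
        rw [Measure.map_apply h1.measurable_prodMk hS, Measure.map_apply h2.measurable_prodMk hS,
          Measure.restrict_apply (h1.measurable_prodMk hS), Measure.smul_apply] at h4
        have h5 : P' ((fun ω k => (Y' k ω, T' k ω)) ⁻¹'
            {z : ℕ → E × ℝ≥0∞ | ¬ ∑' k, (z k).2 = ∞}) = 0 := by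
          have : ∀ᵐ ω ∂P', ∑' k, T' k ω = ∞ := hXY.mono fun ω h => h.1
          exact ae_iff.1 this
        rw [h5, smul_zero] at h4
        rw [ae_iff]
        refine measure_mono_null ?_ h4
        intro ω hω
        simp only [Set.mem_ofPred_eq, Classical.not_imp] at hω
        exact ⟨hω.2, hω.1⟩
      · intro i
        rw [Measure.restrict_apply (h.measurableSet_eq 0 i), Measure.smul_apply, smul_eq_mul]
        by_cases hi : i = a
        · subst hi
          have h4 : P' {ω | Y' 0 ω = i} = 1 := prob_compl_eq_zero_iff
            (h'.measurableSet_eq 0 i) |>.1 (mem_ae_iff.1 hY0)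
          rw [h4, mul_one]
          congr 1
          ext ω
          exact ⟨fun h => h.1, fun h => ⟨h, h⟩⟩
        · have h4 : P' {ω | Y' 0 ω = i} = 0 := by
            refine measure_mono_null (fun ω hω => ?_) (ae_iff.1 hY0)
            rw [Set.mem_ofPred_eq, show Y' 0 ω = i from hω]
            exact hi
          rw [h4, mul_zero]
          convert measure_empty (μ := P)
          refine Set.eq_empty_iff_forall_notMem.2 fun ω hω => hi ?_
          exact hω.1.symm.trans hω.2
  filter_upwards [ae_all_iff.2 key] with ω hω
  exact hω _ rfl

end Recurrence

/-! ### Places and durations of the successive meetings. -/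

section Nth

variable {p : ℕ → Prop}

theorem infinite_shift (hp : {k | p k}.Infinite) : {k | p (k + 1)}.Infinite := by
  refine Set.infinite_of_forall_exists_gt fun N => ?_
  obtain ⟨m, hm, hm'⟩ := hp.exists_gt (N + 1)
  obtain ⟨m, rfl⟩ := Nat.exists_eq_succ_of_ne_zero (by omega : m ≠ 0)
  exact ⟨m, hm, by omega⟩

theorem nth_succ_of_zero (hp : {k | p k}.Infinite) (h0 : p 0) (n : ℕ) :
    Nat.nth p (n + 1) = Nat.nth (fun k => p (k + 1)) n + 1 := by
  have h1 := infinite_shift hp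
  have h2 := Nat.nth_mem_of_infinite h1 n
  have h3 := Nat.count_succ' p (Nat.nth (fun k => p (k + 1)) n)
  rw [Nat.count_nth_of_infinite h1, if_pos h0] at h3
  rw [← h3, Nat.nth_count h2]

theorem nth_of_not_zero (hp : {k | p k}.Infinite) (h0 : ¬ p 0) (n : ℕ) :
    Nat.nth p n = Nat.nth (fun k => p (k + 1)) n + 1 := by
  have h1 := infinite_shift hp
  have h2 := Nat.nth_mem_of_infinite h1 n
  have h3 := Nat.count_succ' p (Nat.nth (fun k => p (k + 1)) n)
  rw [Nat.count_nth_of_infinite h1, if_neg h0, add_zero] at h3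
  conv_lhs => rw [← h3]
  exact Nat.nth_count h2

/-- Serves the measurability of the meeting indices on the whole space. The second alternative is
the default value `0` of `Nat.nth` when there is no `n`-th index. -/
theorem nth_eq_iff (n m : ℕ) : Nat.nth p n = m ↔
    (p m ∧ Nat.count p m = n) ∨ (m = 0 ∧ ∀ j, ¬ (p j ∧ Nat.count p j = n)) := by
  have h1 : ∀ j, p j ∧ Nat.count p j = n → Nat.nth p n = j := by
    rintro j ⟨h1, rfl⟩
    exact Nat.nth_count h1
  constructor
  · rintro rfl
    by_cases h : ∃ j, p j ∧ Nat.count p j = n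
    · obtain ⟨j, hj⟩ := h
      rw [h1 j hj]
      exact Or.inl hj
    · push Not at h
      refine Or.inr ⟨?_, fun j hj => h j hj.1 hj.2⟩
      by_contra h2
      exact h _ (Nat.nth_mem_of_ne_zero h2) (Nat.count_nth (Nat.lt_card_toFinset_of_nth_ne_zero h2))
  · rintro (h | ⟨rfl, h⟩)
    · exact h1 m h
    · by_contra h2
      exact h _ ⟨Nat.nth_mem_of_ne_zero h2,
        Nat.count_nth (Nat.lt_card_toFinset_of_nth_ne_zero h2)⟩

end Nth

section Mouse

variable {E : Type*} {Ω : Type*}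

/-- The index of the `n`-th meeting (starting with `n = 0`). -/
noncomputable def meetingTime (Y : ℕ → Ω → E × E) (n : ℕ) (ω : Ω) : ℕ :=
  Nat.nth (fun k => (Y k ω).1 = (Y k ω).2) n

/-- The place of the `n`-th meeting. -/
noncomputable def meetingState (Y : ℕ → Ω → E × E) (n : ℕ) (ω : Ω) : E :=
  (Y (meetingTime Y n ω) ω).2

/-- The duration of the `n`-th meeting. -/
noncomputable def meetingHold (Y : ℕ → Ω → E × E) (T : ℕ → Ω → ℝ≥0∞) (n : ℕ) (ω : Ω) : ℝ≥0∞ :=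
  T (meetingTime Y n ω) ω

theorem meetingTime_zero_of_eq {Y : ℕ → Ω → E × E} {ω : Ω} (h0 : (Y 0 ω).1 = (Y 0 ω).2) :
    meetingTime Y 0 ω = 0 :=
  Nat.nth_zero_of_zero (p := fun k => (Y k ω).1 = (Y k ω).2) h0

theorem meetingTime_succ_of_eq {Y : ℕ → Ω → E × E} {ω : Ω}
    (hω : {k | (Y k ω).1 = (Y k ω).2}.Infinite) (h0 : (Y 0 ω).1 = (Y 0 ω).2) (n : ℕ) :
    meetingTime Y (n + 1) ω = meetingTime (fun k => Y (k + 1)) n ω + 1 :=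
  nth_succ_of_zero hω h0 n

theorem meetingTime_of_ne {Y : ℕ → Ω → E × E} {ω : Ω}
    (hω : {k | (Y k ω).1 = (Y k ω).2}.Infinite) (h0 : (Y 0 ω).1 ≠ (Y 0 ω).2) (n : ℕ) :
    meetingTime Y n ω = meetingTime (fun k => Y (k + 1)) n ω + 1 :=
  nth_of_not_zero hω h0 n

variable [MeasurableSpace E] [Countable E] [MeasurableSingletonClass E] [MeasurableSpace Ω]
  {q : E → E → ℝ} {P : Measure Ω} {Y : ℕ → Ω → E × E} {T : ℕ → Ω → ℝ≥0∞}

theorem measurable_meetingTime (hY : ∀ n, Measurable (Y n)) (n : ℕ) :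
    Measurable (meetingTime Y n) := by
  have hd : ∀ m, MeasurableSet {ω | (Y m ω).1 = (Y m ω).2} := fun m =>
    hY m (MeasurableSet.of_discrete (s := {b : E × E | b.1 = b.2}))
  have hc : ∀ m, Measurable fun ω => Nat.count (fun k => (Y k ω).1 = (Y k ω).2) m := by
    intro m
    induction m with
    | zero => simp only [Nat.count_zero]; exact measurable_const
    | succ m ih =>
      simp only [Nat.count_succ]
      exact ih.add (Measurable.ite (hd m) measurable_const measurable_const)
  have hj : ∀ m, MeasurableSet {ω | (Y m ω).1 = (Y m ω).2 ∧
      Nat.count (fun k => (Y k ω).1 = (Y k ω).2) m = n} := fun m =>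
    (hd m).inter (hc m (measurableSet_singleton n))
  refine measurable_to_countable' fun m => ?_
  have : meetingTime Y n ⁻¹' {m} = {ω | (Y m ω).1 = (Y m ω).2 ∧
      Nat.count (fun k => (Y k ω).1 = (Y k ω).2) m = n} ∪ ({_ω : Ω | m = 0} ∩
        ⋂ j, {ω | (Y j ω).1 = (Y j ω).2 ∧
          Nat.count (fun k => (Y k ω).1 = (Y k ω).2) j = n}ᶜ) := by
    ext ω
    simpa [meetingTime] using nth_eq_iff (p := fun k => (Y k ω).1 = (Y k ω).2) n m
  rw [this]
  exact (hj m).union ((MeasurableSet.const _).inter (MeasurableSet.iInter fun j => (hj j).compl))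

theorem measurable_comp_meetingTime (hY : ∀ n, Measurable (Y n)) {F : Type*} [MeasurableSpace F]
    {Z : ℕ → Ω → F} (hZ : ∀ n, Measurable (Z n)) (n : ℕ) :
    Measurable fun ω => Z (meetingTime Y n ω) ω := by
  have h1 : Measurable fun p : Ω × ℕ => Z p.2 p.1 := measurable_from_prod_countable_left hZ
  exact h1.comp (measurable_id.prodMk (measurable_meetingTime hY n))

theorem measurable_meetingState (hY : ∀ n, Measurable (Y n)) (n : ℕ) :
    Measurable (meetingState Y n) :=
  measurable_snd.comp (measurable_comp_meetingTime hY hY n)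

theorem measurable_meetingHold (hY : ∀ n, Measurable (Y n)) (hT : ∀ n, Measurable (T n)) (n : ℕ) :
    Measurable (meetingHold Y T n) :=
  measurable_comp_meetingTime hY hT n

/-- The mouse does not move when the cat is elsewhere. -/
theorem IsJumpHold.mouse_const (hq : IsQMatrix q) [IsFiniteMeasure P]
    (h : IsJumpHold (catMouseMatrix q) Y T P) :
    ∀ᵐ ω ∂P, ∀ k, (Y k ω).1 ≠ (Y k ω).2 → (Y (k + 1) ω).2 = (Y k ω).2 := by
  have hcm := isQMatrix_catMouseMatrix hq
  have key : ∀ {T : ℕ → Ω → ℝ≥0∞} {Y : ℕ → Ω → E × E}, IsJumpHold (catMouseMatrix q) Y T P →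
      ∀ᵐ ω ∂P, (Y 0 ω).1 ≠ (Y 0 ω).2 → (Y 1 ω).2 = (Y 0 ω).2 := by
    intro T Y h
    have h1 : ∀ a b : E × E, ∀ᵐ ω ∂P, a.1 ≠ a.2 → b.2 ≠ a.2 → ¬ (Y 0 ω = a ∧ Y 1 ω = b) := by
      intro a b
      by_cases ha : a.1 ≠ a.2 ∧ b.2 ≠ a.2
      · have h2 := h.law_transition hcm a b
        rw [jumpProb_catMouseMatrix_of_ne hq ha.1, if_neg ha.2, mul_zero] at h2
        filter_upwards [measure_eq_zero_iff_ae_notMem.1 h2] with ω hω _ _ using hω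
      · exact Filter.Eventually.of_forall fun ω h3 h4 => absurd ⟨h3, h4⟩ ha
    filter_upwards [ae_all_iff.2 fun a => ae_all_iff.2 (h1 a)] with ω hω h0
    by_contra h2
    exact hω _ _ h0 h2 ⟨rfl, rfl⟩
  refine ae_all_iff.2 fun k => ?_
  have h1 := key (h.shift_add hcm k)
  simpa only [zero_add, add_comm 1 k] using h1

theorem IsJumpHold.ae_infinite_meetings (hq : IsQMatrix q) [IsFiniteMeasure P]
    (hD : ∀ a, ⨅ n, avoidProb (jumpProb (catMouseMatrix q)) {b | b.1 = b.2} n a = 0)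
    (h : IsJumpHold (catMouseMatrix q) Y T P) :
    ∀ᵐ ω ∂P, {k | (Y k ω).1 = (Y k ω).2}.Infinite := by
  filter_upwards [h.ae_frequently_mem (isQMatrix_catMouseMatrix hq) hD] with ω hω
  refine Set.infinite_of_forall_exists_gt fun N => ?_
  obtain ⟨k, hk⟩ := hω (N + 1)
  exact ⟨k + (N + 1), hk, by omega⟩

theorem measurableSet_meetingCylinder (hY : ∀ n, Measurable (Y n)) (hT : ∀ n, Measurable (T n))
    (n : ℕ) (i : ℕ → E) (t : ℕ → ℝ≥0) :
    MeasurableSet {ω | ∀ k ≤ n, meetingState Y k ω = i k ∧ (t k : ℝ≥0∞) < meetingHold Y T k ω} :=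
  measurableSet_cylinder (measurable_meetingState hY) (measurable_meetingHold hY hT) n i t

/-- If the law of the meetings is known when the chain starts with a meeting, then it is known
in general. -/
theorem law_meetings_of_law_diag (hq : IsQMatrix q)
    (hD : ∀ a, ⨅ n, avoidProb (jumpProb (catMouseMatrix q)) {b | b.1 = b.2} n a = 0)
    {n : ℕ} {i : ℕ → E} {t : ℕ → ℝ≥0} {W : ℝ≥0∞}
    (hdiag : ∀ {P : Measure Ω} [IsFiniteMeasure P] {Y : ℕ → Ω → E × E} {T : ℕ → Ω → ℝ≥0∞},
      IsJumpHold (catMouseMatrix q) Y T P →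
      P {ω | (∀ k ≤ n, meetingState Y k ω = i k ∧ (t k : ℝ≥0∞) < meetingHold Y T k ω) ∧
        (Y 0 ω).1 = (Y 0 ω).2} = P {ω | (Y 0 ω).2 = i 0 ∧ (Y 0 ω).1 = (Y 0 ω).2} * W)
    [IsFiniteMeasure P] (h : IsJumpHold (catMouseMatrix q) Y T P) :
    P {ω | ∀ k ≤ n, meetingState Y k ω = i k ∧ (t k : ℝ≥0∞) < meetingHold Y T k ω} =
      P {ω | (Y 0 ω).2 = i 0} * W := by
  have hcm := isQMatrix_catMouseMatrix hq
  -- Induction on the index `N` of the first meeting. If it is positive, shifting the chain by one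
  -- keeps the meetings, and also the position of the mouse, which does not move when alone.
  have key : ∀ (N : ℕ) {P : Measure Ω} [IsFiniteMeasure P] {Y : ℕ → Ω → E × E}
      {T : ℕ → Ω → ℝ≥0∞}, IsJumpHold (catMouseMatrix q) Y T P →
      P {ω | (∀ k ≤ n, meetingState Y k ω = i k ∧ (t k : ℝ≥0∞) < meetingHold Y T k ω) ∧
        meetingTime Y 0 ω = N} = P {ω | (Y 0 ω).2 = i 0 ∧ meetingTime Y 0 ω = N} * W := by
    intro N
    induction N with
    | zero =>
      intro P _ Y T h
      -- Only almost surely: `meetingTime` is also `0` when there is no meeting at all.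
      have h1 : ∀ᵐ ω ∂P, meetingTime Y 0 ω = 0 ↔ (Y 0 ω).1 = (Y 0 ω).2 := by
        filter_upwards [h.ae_infinite_meetings hq hD] with ω hω
        refine ⟨fun h2 => ?_, meetingTime_zero_of_eq⟩
        by_contra h3
        rw [meetingTime_of_ne hω h3] at h2
        omega
      refine (measure_congr (Filter.eventuallyEq_set.2 ?_)).trans ((hdiag h).trans
        (congrArg (· * W) (measure_congr (Filter.eventuallyEq_set.2 ?_))))
      · filter_upwards [h1] with ω hω
        exact and_congr_right fun _ => hω
      · filter_upwards [h1] with ω hω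
        exact and_congr_right fun _ => hω.symm
    | succ N ih =>
      intro P _ Y T h
      have hY' : ∀ n, Measurable (Y (n + 1)) := fun n => h.measurable_state (n + 1)
      have hτ : MeasurableSet {ω | meetingTime (fun k => Y (k + 1)) 0 ω = N} :=
        measurable_meetingTime hY' 0 (measurableSet_singleton N)
      have h1 : ∀ᵐ ω ∂P, meetingTime Y 0 ω = N + 1 ↔
          meetingTime (fun k => Y (k + 1)) 0 ω = N ∧ (Y 0 ω).1 ≠ (Y 0 ω).2 := by
        filter_upwards [h.ae_infinite_meetings hq hD] with ω hω
        constructor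
        · intro h2
          have h3 : (Y 0 ω).1 ≠ (Y 0 ω).2 := by
            intro h3
            rw [meetingTime_zero_of_eq h3] at h2
            omega
          rw [meetingTime_of_ne hω h3] at h2
          exact ⟨by omega, h3⟩
        · rintro ⟨h2, h3⟩
          rw [meetingTime_of_ne hω h3, h2]
      have h2 := ih (h.shift_restrict_mem hcm {a | a.1 ≠ a.2})
      have hm1 : MeasurableSet {ω | (∀ k ≤ n, meetingState (fun k => Y (k + 1)) k ω = i k ∧
          (t k : ℝ≥0∞) < meetingHold (fun k => Y (k + 1)) (fun k => T (k + 1)) k ω) ∧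
          meetingTime (fun k => Y (k + 1)) 0 ω = N} :=
        (measurableSet_meetingCylinder hY' (fun n => h.measurable_hold (n + 1)) n i t).inter hτ
      have hm2 : MeasurableSet {ω | (Y (0 + 1) ω).2 = i 0 ∧
          meetingTime (fun k => Y (k + 1)) 0 ω = N} :=
        (h.measurableSet_state 1 {a | a.2 = i 0}).inter hτ
      rw [Measure.restrict_apply hm1, Measure.restrict_apply hm2] at h2
      refine (measure_congr (Filter.eventuallyEq_set.2 ?_)).trans (h2.trans
        (congrArg (· * W) (measure_congr (Filter.eventuallyEq_set.2 ?_))))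
      · filter_upwards [h1, h.ae_infinite_meetings hq hD] with ω h3 hω
        simp only [Set.mem_inter_iff, Set.mem_ofPred_eq]
        rw [h3, and_assoc]
        refine and_congr_left fun h4 => ?_
        have h5 := meetingTime_of_ne hω h4.2
        simp only [meetingState, meetingHold, h5]
      · filter_upwards [h1, h.mouse_const hq] with ω h3 h4
        simp only [Set.mem_inter_iff, Set.mem_ofPred_eq]
        rw [h3, and_assoc]
        refine and_congr_left fun h5 => ?_
        rw [h4 0 h5.2]
  have hm := measurableSet_meetingCylinder h.measurable_state h.measurable_hold n i t
  have hm' : MeasurableSet {ω | (Y 0 ω).2 = i 0} := h.measurableSet_state 0 {a | a.2 = i 0}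
  rw [← tsum_measure_and_eq (measurable_meetingTime h.measurable_state 0) hm,
    ← tsum_measure_and_eq (measurable_meetingTime h.measurable_state 0) hm',
    ← ENNReal.tsum_mul_right]
  exact tsum_congr fun N => key N h

/-- By `law_meetings_of_law_diag` the chain may be started on the diagonal, hence at `(i 0, i 0)`.
There the first meeting is the first holding time, with rate `q_{i 0}`, and the mouse then goes to
`i 1` with probability `p(i 0, i 1)`. The induction hypothesis for the shifted chain involves only
the mouse's initial position, so the cat's landing point is irrelevant. -/
theorem law_meetings (hq : IsQMatrix q)
    (hD : ∀ a, ⨅ n, avoidProb (jumpProb (catMouseMatrix q)) {b | b.1 = b.2} n a = 0)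
    (n : ℕ) : ∀ (i : ℕ → E) (t : ℕ → ℝ≥0) {P : Measure Ω} [IsFiniteMeasure P]
      {Y : ℕ → Ω → E × E} {T : ℕ → Ω → ℝ≥0∞}, IsJumpHold (catMouseMatrix q) Y T P →
    P {ω | ∀ k ≤ n, meetingState Y k ω = i k ∧ (t k : ℝ≥0∞) < meetingHold Y T k ω} =
      P {ω | (Y 0 ω).2 = i 0} * pathWeight q n i t := by
  have hcm := isQMatrix_catMouseMatrix hq
  have hfib : ∀ (n : ℕ) (i : ℕ → E) (t : ℕ → ℝ≥0) {P : Measure Ω} [IsFiniteMeasure P]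
      {Y : ℕ → Ω → E × E} {T : ℕ → Ω → ℝ≥0∞}, IsJumpHold (catMouseMatrix q) Y T P →
      P {ω | (∀ k ≤ n, meetingState Y k ω = i k ∧ (t k : ℝ≥0∞) < meetingHold Y T k ω) ∧
        Y 0 ω = (i 0, i 0)} = P {ω | Y 0 ω = (i 0, i 0)} * pathWeight q n i t →
      P {ω | (∀ k ≤ n, meetingState Y k ω = i k ∧ (t k : ℝ≥0∞) < meetingHold Y T k ω) ∧
        (Y 0 ω).1 = (Y 0 ω).2} =
          P {ω | (Y 0 ω).2 = i 0 ∧ (Y 0 ω).1 = (Y 0 ω).2} * pathWeight q n i t := by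
    intro n i t P _ Y T h h1
    convert h1 using 3
    · ext ω
      refine and_congr_right fun h2 => ⟨fun h3 => ?_, fun h3 => by rw [h3]⟩
      have h4 := (h2 0 n.zero_le).1
      rw [meetingState, meetingTime_zero_of_eq h3] at h4
      exact Prod.ext (h3.trans h4) h4
    · ext ω
      exact ⟨fun h3 => Prod.ext (h3.2.trans h3.1) h3.1, fun h3 =>
        ⟨by rw [show Y 0 ω = _ from h3], by rw [show Y 0 ω = _ from h3]⟩⟩
  induction n with
  | zero =>
    intro i t P _ Y T h
    refine law_meetings_of_law_diag hq hD (fun {P} _ {Y T} h => hfib 0 i t h ?_) h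
    have h1 := h.law_zero (i 0, i 0) (t 0)
    rw [exitRate_catMouseMatrix hq] at h1
    rw [pathWeight_zero, ← h1]
    congr 1
    ext ω
    simp only [Nat.le_zero, forall_eq, Set.mem_ofPred_eq]
    have h2 : Y 0 ω = (i 0, i 0) → meetingTime Y 0 ω = 0 := fun h3 =>
      meetingTime_zero_of_eq (by rw [h3])
    constructor
    · rintro ⟨⟨-, h3⟩, h4⟩
      rw [meetingHold, h2 h4] at h3
      exact ⟨h4, h3⟩
    · rintro ⟨h4, h3⟩
      rw [meetingHold, meetingState, h2 h4, h4]
      exact ⟨⟨rfl, h3⟩, rfl⟩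
  | succ n ih =>
    intro i t P _ Y T h
    refine law_meetings_of_law_diag hq hD (fun {P} _ {Y T} h => hfib (n + 1) i t h ?_) h
    have hm1 := measurableSet_meetingCylinder (fun n => h.measurable_state (n + 1))
      (fun n => h.measurable_hold (n + 1)) n (fun k => i (k + 1)) (fun k => t (k + 1))
    have hm2 : MeasurableSet {ω | (Y (0 + 1) ω).2 = i (0 + 1)} :=
      h.measurableSet_state 1 {a | a.2 = i 1}
    have h2 := ih (fun k => i (k + 1)) (fun k => t (k + 1))
      (h.shift_restrict_lt hcm (i 0, i 0) (t 0))
    rw [Measure.restrict_apply hm1, Measure.restrict_apply hm2] at h2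
    have h3 := h.law_step_mem hcm (i 0, i 0) (t 0) {b | b.2 = i 1}
    rw [tsum_jumpProb_catMouseMatrix_snd hq, exitRate_catMouseMatrix hq] at h3
    have h4 : {ω | (Y (0 + 1) ω).2 = i (0 + 1)} ∩
        {ω | Y 0 ω = (i 0, i 0) ∧ (t 0 : ℝ≥0∞) < T 0 ω} =
        {ω | (Y 0 ω = (i 0, i 0) ∧ (t 0 : ℝ≥0∞) < T 0 ω) ∧ Y 1 ω ∈ {b : E × E | b.2 = i 1}} :=
      Set.inter_comm _ _
    rw [h4, h3] at h2
    rw [pathWeight_succ, ← mul_assoc, ← mul_assoc]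
    refine Eq.trans (measure_congr (Filter.eventuallyEq_set.2 ?_)) h2
    filter_upwards [h.ae_infinite_meetings hq hD] with ω hω
    simp only [Set.mem_inter_iff, Set.mem_ofPred_eq]
    have h5 : Y 0 ω = (i 0, i 0) → (Y 0 ω).1 = (Y 0 ω).2 := fun h6 => by rw [h6]
    constructor
    · rintro ⟨h6, h7⟩
      refine ⟨fun k hk => ?_, h7, ?_⟩
      · have h8 := h6 (k + 1) (by omega)
        rwa [meetingState, meetingHold, meetingTime_succ_of_eq hω (h5 h7)] at h8
      · have h8 := (h6 0 (by omega)).2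
        rwa [meetingHold, meetingTime_zero_of_eq (h5 h7)] at h8
    · rintro ⟨h6, h7, h8⟩
      refine ⟨fun k hk => ?_, h7⟩
      cases k with
      | zero =>
        rw [meetingState, meetingHold, meetingTime_zero_of_eq (h5 h7), h7]
        exact ⟨rfl, h8⟩
      | succ k =>
        rw [meetingState, meetingHold, meetingTime_succ_of_eq hω (h5 h7)]
        exact h6 k (by omega)

/-- The places and durations of the successive meetings form a jump chain with `Q`-matrix `q`. -/
theorem IsJumpHold.meetings (hq : IsQMatrix q)
    (hD : ∀ a, ⨅ n, avoidProb (jumpProb (catMouseMatrix q)) {b | b.1 = b.2} n a = 0)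
    [IsFiniteMeasure P] (h : IsJumpHold (catMouseMatrix q) Y T P) :
    IsJumpHold q (meetingState Y) (meetingHold Y T) P := by
  refine isJumpHold_of_law_pathWeight (measurable_meetingState h.measurable_state)
    (measurable_meetingHold h.measurable_state h.measurable_hold) fun n i t => ?_
  rw [law_meetings hq hD n i t h]
  congr 1
  -- With threshold `0` this identifies the law of the first meeting place with that of the mouse's
  -- initial position.
  have h1 := law_meetings hq hD 0 i (fun _ => 0) h
  simp only [pathWeight_zero, NNReal.coe_zero, mul_zero, neg_zero, Real.exp_zero,
    ENNReal.ofReal_one, mul_one, Nat.le_zero, forall_eq] at h1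
  rw [← h1]
  refine measure_congr (Filter.eventuallyEq_set.2 ?_)
  filter_upwards [h.hold_pos (isQMatrix_catMouseMatrix hq)] with ω hω
  exact and_iff_left (hω _)

end Mouse

/-! ### Deterministic analysis of a path: the clock `U` and its inverse `S`. -/

section Path

variable {E Ω : Type*} {C M : ℝ≥0 → Ω → E} {ω : Ω}

theorem exists_coe_eq {x : ℝ≥0∞} (hx : x ≠ ∞) : ∃ a : ℝ≥0, (a : ℝ≥0∞) = x :=
  ⟨_, ENNReal.coe_toNNReal hx⟩

/-- The open interval leaves out the instant `t + r`, which may be a jump time; end points are null.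
-/
theorem timeTogether_add (t r : ℝ≥0) : timeTogether C M (t + r) ω = timeTogether C M t ω +
    ∫⁻ s in Set.Ioo (t : ℝ) (t + r), (if M s.toNNReal ω = C s.toNNReal ω then 1 else 0) := by
  have h1 : Set.Icc (0 : ℝ) ((t + r : ℝ≥0) : ℝ) = Set.Icc (0 : ℝ) t ∪ Set.Ioc (t : ℝ) (t + r) := by
    exact (Set.Icc_union_Ioc_eq_Icc t.2 (le_add_of_nonneg_right r.2)).symm
  rw [timeTogether, timeTogether, h1, lintegral_union measurableSet_Ioc,
    restrict_Ioo_eq_restrict_Ioc]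
  exact Set.disjoint_left.2 fun s h2 h3 => absurd h2.2 (not_le.2 h3.1)

theorem timeTogether_add_le (t r : ℝ≥0) :
    timeTogether C M (t + r) ω ≤ timeTogether C M t ω + r := by
  rw [timeTogether_add]
  gcongr
  calc ∫⁻ s in Set.Ioo (t : ℝ) (t + r), (if M s.toNNReal ω = C s.toNNReal ω then 1 else 0)
      ≤ ∫⁻ _ in Set.Ioo (t : ℝ) (t + r), (1 : ℝ≥0∞) :=
        lintegral_mono fun s => by split_ifs <;> simp
    _ = r := by simp

theorem timeTogether_mono : Monotone fun t => timeTogether C M t ω := by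
  intro s t hst
  obtain ⟨r, rfl⟩ := exists_add_of_le hst
  simp only [timeTogether_add]
  exact le_self_add

theorem timeTogether_zero : timeTogether C M 0 ω = 0 := by
  simp [timeTogether]

/-- Deterministic description of a path of the cat and mouse chain: it sits at `y n` during the
`n`-th holding time, the mouse moves only after a meeting, and there are infinitely many
meetings. -/
structure IsMeetingPath (y : ℕ → E × E) (T : ℕ → ℝ≥0∞) (C M : ℝ≥0 → Ω → E) (ω : Ω) : Prop where
  hold_pos : ∀ k, 0 < T k
  tsum_hold : ∑' k, T k = ∞
  path_eq : ∀ (t : ℝ≥0) (n : ℕ), ∑ k ∈ Finset.range n, T k ≤ t →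
    t < ∑ k ∈ Finset.range (n + 1), T k → (C t ω, M t ω) = y n
  infinite : {k | (y k).1 = (y k).2}.Infinite
  mouse_const : ∀ k, (y k).1 ≠ (y k).2 → (y (k + 1)).2 = (y k).2
  hold_lt_top : ∀ k, (y k).1 ≠ (y k).2 → T k < ∞

namespace IsMeetingPath

variable {y : ℕ → E × E} {T : ℕ → ℝ≥0∞}

theorem timeTogether_add_hold (h : IsMeetingPath y T C M ω) {n : ℕ} {t r : ℝ≥0}
    (h1 : ∑ k ∈ Finset.range n, T k ≤ t)
    (h2 : ((t + r : ℝ≥0) : ℝ≥0∞) ≤ ∑ k ∈ Finset.range (n + 1), T k) :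
    timeTogether C M (t + r) ω =
      timeTogether C M t ω + if (y n).1 = (y n).2 then (r : ℝ≥0∞) else 0 := by
  rw [timeTogether_add]
  congr 1
  have h3 : ∀ s ∈ Set.Ioo (t : ℝ) (t + r),
      (if M s.toNNReal ω = C s.toNNReal ω then (1 : ℝ≥0∞) else 0) =
        if (y n).1 = (y n).2 then 1 else 0 := by
    intro s hs
    have h4 : t ≤ s.toNNReal := by
      rw [← NNReal.coe_le_coe, Real.coe_toNNReal s (t.2.trans hs.1.le)]
      exact hs.1.le
    have h5 : s.toNNReal < t + r := by
      rw [← NNReal.coe_lt_coe, Real.coe_toNNReal s (t.2.trans hs.1.le)]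
      exact hs.2
    have h6 := h.path_eq s.toNNReal n (h1.trans (by exact_mod_cast h4))
      (lt_of_lt_of_le (by exact_mod_cast h5) h2)
    rw [← h6]
    simp only [eq_comm]
  rw [setLIntegral_congr_fun measurableSet_Ioo h3]
  split_ifs <;> simp

theorem timeTogether_jumpTime (h : IsMeetingPath y T C M ω) (n : ℕ) : ∀ s : ℝ≥0,
    ∑ k ∈ Finset.range n, T k = s →
      timeTogether C M s ω = ∑ k ∈ Finset.range n with (y k).1 = (y k).2, T k := by
  induction n with
  | zero =>
    intro s hs
    have : s = 0 := by simpa using hs.symm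
    simp [this, timeTogether_zero]
  | succ n ih =>
    intro s hs
    rw [Finset.sum_range_succ] at hs
    have h1 : ∑ k ∈ Finset.range n, T k ≠ ∞ := fun h0 => by simp [h0] at hs
    have h2 : T n ≠ ∞ := fun h0 => by simp [h0] at hs
    obtain ⟨a, ha⟩ := exists_coe_eq h1
    obtain ⟨r, hr⟩ := exists_coe_eq h2
    rw [← ha, ← hr] at hs
    obtain rfl : a + r = s := by exact_mod_cast hs
    rw [h.timeTogether_add_hold (n := n) ha.symm.le
      (by rw [Finset.sum_range_succ, ← ha, ← hr, ENNReal.coe_add]), ih a ha.symm,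
      Finset.sum_filter, Finset.sum_filter, Finset.sum_range_succ, hr]

theorem not_meeting_of_lt (h : IsMeetingPath y T C M ω) {n k : ℕ}
    (h1 : ∀ m < n, Nat.nth (fun k => (y k).1 = (y k).2) m < k)
    (h2 : k < Nat.nth (fun k => (y k).1 = (y k).2) n) : (y k).1 ≠ (y k).2 := by
  intro h3
  have h4 := Nat.nth_count (p := fun k => (y k).1 = (y k).2) h3
  rw [← h4, Nat.nth_lt_nth h.infinite] at h2
  exact (h1 _ h2).ne h4

theorem sum_meetings (h : IsMeetingPath y T C M ω) (n : ℕ) :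
    ∑ k ∈ Finset.range (Nat.nth (fun k => (y k).1 = (y k).2) n) with (y k).1 = (y k).2, T k =
      ∑ j ∈ Finset.range n, T (Nat.nth (fun k => (y k).1 = (y k).2) j) := by
  induction n with
  | zero =>
    rw [Finset.range_zero, Finset.sum_empty]
    refine Finset.sum_eq_zero fun k hk => ?_
    rw [Finset.mem_filter, Finset.mem_range] at hk
    exact absurd hk.2 (h.not_meeting_of_lt (n := 0) (by simp) hk.1)
  | succ n ih =>
    rw [Nat.filter_range_nth_eq_insert_of_infinite h.infinite, Finset.sum_insert (by simp), ih,
      Finset.sum_range_succ, add_comm]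

theorem mouse_eq (h : IsMeetingPath y T C M ω) {m n : ℕ} (hmn : m ≤ n)
    (h1 : ∀ k, m ≤ k → k < n → (y k).1 ≠ (y k).2) : (y n).2 = (y m).2 := by
  induction n, hmn using Nat.le_induction with
  | base => rfl
  | succ n hmn ih =>
    rw [h.mouse_const n (h1 n hmn n.lt_succ_self), ih fun k hk hk' => h1 k hk (by omega)]

/-- Periods apart are finite, so only an earlier meeting could last for ever. -/
theorem sum_range_nth_ne_top (h : IsMeetingPath y T C M ω) {n : ℕ}
    (hn : ∑ j ∈ Finset.range n, T (Nat.nth (fun k => (y k).1 = (y k).2) j) ≠ ∞) :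
    ∑ k ∈ Finset.range (Nat.nth (fun k => (y k).1 = (y k).2) n), T k ≠ ∞ := by
  refine (ENNReal.sum_lt_top.2 fun k hk => ?_).ne
  by_cases h1 : (y k).1 = (y k).2
  · have h4 := Nat.nth_count (p := fun k => (y k).1 = (y k).2) h1
    rw [Finset.mem_range] at hk
    rw [← h4, Nat.nth_lt_nth h.infinite] at hk
    rw [← h4]
    exact ENNReal.sum_lt_top.1 (lt_top_iff_ne_top.2 hn) _ (Finset.mem_range.2 hk)
  · exact h.hold_lt_top k h1

theorem timeTogether_meeting (h : IsMeetingPath y T C M ω) {n : ℕ} {a r : ℝ≥0}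
    (ha : ∑ k ∈ Finset.range (Nat.nth (fun k => (y k).1 = (y k).2) n), T k = a)
    (hr : (r : ℝ≥0∞) ≤ T (Nat.nth (fun k => (y k).1 = (y k).2) n)) :
    timeTogether C M (a + r) ω =
      ∑ j ∈ Finset.range n, T (Nat.nth (fun k => (y k).1 = (y k).2) j) + r := by
  rw [h.timeTogether_add_hold ha.le, h.timeTogether_jumpTime _ a ha, h.sum_meetings,
    if_pos (Nat.nth_mem_of_infinite h.infinite n)]
  rw [Finset.sum_range_succ, ha, ENNReal.coe_add]
  gcongr

/-- The inverse time `S(t)` for `t` in the duration of the `n`-th meeting. -/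
theorem inverseTime_spec (h : IsMeetingPath y T C M ω) {n : ℕ} {t : ℝ≥0}
    (h1 : ∑ j ∈ Finset.range n, T (Nat.nth (fun k => (y k).1 = (y k).2) j) ≤ t)
    (h2 : t < ∑ j ∈ Finset.range (n + 1), T (Nat.nth (fun k => (y k).1 = (y k).2) j)) :
    timeTogether C M (inverseTime C M t ω) ω = t ∧
      M (inverseTime C M t ω) ω = (y (Nat.nth (fun k => (y k).1 = (y k).2) n)).2 := by
  have hJmono : ∀ {m n : ℕ}, m ≤ n → ∑ k ∈ Finset.range m, T k ≤ ∑ k ∈ Finset.range n, T k :=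
    fun hmn => Finset.sum_le_sum_of_subset (Finset.range_mono hmn)
  have hfin := (h1.trans_lt ENNReal.coe_lt_top).ne
  -- `a` is the real time at which the `n`-th meeting starts, `b` the time spent together before it;
  -- with `t = b + r`, the clock `U` shows `t` at time `a + r`.
  obtain ⟨a, ha⟩ := exists_coe_eq (h.sum_range_nth_ne_top hfin)
  obtain ⟨b, hb⟩ := exists_coe_eq hfin
  rw [← hb] at h1
  obtain ⟨r, rfl⟩ := exists_add_of_le (show b ≤ t by exact_mod_cast h1)
  have hr : (r : ℝ≥0∞) < T (Nat.nth (fun k => (y k).1 = (y k).2) n) := by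
    rw [Finset.sum_range_succ, ← hb, ENNReal.coe_add] at h2
    exact (ENNReal.add_lt_add_iff_left ENNReal.coe_ne_top).1 h2
  have hU : timeTogether C M (a + r) ω = ((b + r : ℝ≥0) : ℝ≥0∞) := by
    rw [h.timeTogether_meeting ha.symm hr.le, ← hb, ENNReal.coe_add]
  set t := b + r with ht
  set S := inverseTime C M t ω with hS
  -- The `ε` is there because the infimum runs over positive times only and `a + r` may be `0`.
  have hmem : ∀ ε : ℝ≥0, 0 < ε →
      a + r + ε ∈ {s : ℝ≥0 | 0 < s ∧ (t : ℝ≥0∞) ≤ timeTogether C M s ω} := fun ε hε =>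
    ⟨by positivity, hU.symm.le.trans (timeTogether_mono le_self_add)⟩
  have hS1 : S ≤ a + r := le_of_forall_pos_le_add fun ε hε => csInf_le (OrderBot.bddBelow _) (hmem ε hε)
  have hUS : timeTogether C M S ω = t := by
    -- The lower bound is the continuity of `U` at the infimum, in the form of a Lipschitz estimate.
    refine le_antisymm ((timeTogether_mono hS1).trans hU.le) ?_
    refine ENNReal.le_of_forall_pos_le_add fun ε hε _ => ?_
    obtain ⟨s, hs, hs'⟩ := exists_lt_of_csInf_lt ⟨_, hmem 1 one_pos⟩
      (show sInf _ < S + ε from lt_add_of_pos_right S hε)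
    exact (hs.2.trans (timeTogether_mono hs'.le)).trans (timeTogether_add_le S ε)
  refine ⟨hUS, ?_⟩
  have hS2 : (S : ℝ≥0∞) <
      ∑ k ∈ Finset.range (Nat.nth (fun k => (y k).1 = (y k).2) n + 1), T k := by
    rw [Finset.sum_range_succ, ← ha]
    calc (S : ℝ≥0∞) ≤ a + r := by exact_mod_cast hS1
      _ < a + _ := (ENNReal.add_lt_add_iff_left ENNReal.coe_ne_top).2 hr
  -- `S` does not precede the end of an earlier meeting `m`: before that end `U` is smaller than the
  -- total duration of the meetings up to `m`, which is at most `t`. Equality can occur and is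
  -- harmless, since the mouse has already jumped at the end of the meeting.
  have hS3 : ∀ m < n, ∑ k ∈ Finset.range (Nat.nth (fun k => (y k).1 = (y k).2) m + 1), T k ≤ S := by
    intro m hm
    by_contra! hlt
    have hm' : ∑ j ∈ Finset.range (m + 1), T (Nat.nth (fun k => (y k).1 = (y k).2) j) ≤ t :=
      (Finset.sum_le_sum_of_subset (Finset.range_mono hm)).trans (hb.symm.le.trans h1)
    have hfm : ∑ j ∈ Finset.range m, T (Nat.nth (fun k => (y k).1 = (y k).2) j) ≠ ∞ := by
      refine ne_top_of_le_ne_top ENNReal.coe_ne_top (le_trans ?_ hm')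
      exact Finset.sum_le_sum_of_subset (Finset.range_mono m.le_succ)
    obtain ⟨c, hc⟩ := exists_coe_eq (h.sum_range_nth_ne_top hfm)
    rw [← hUS, Finset.sum_range_succ] at hm'
    refine absurd hm' (not_le.2 ?_)
    rcases le_total S c with hSc | hSc
    · have h3 := h.timeTogether_meeting (r := 0) hc.symm (by simp)
      rw [add_zero, ENNReal.coe_zero, add_zero] at h3
      refine (timeTogether_mono hSc).trans_lt ?_
      beta_reduce
      rw [h3]
      exact ENNReal.lt_add_right hfm (h.hold_pos _).ne'
    · obtain ⟨d, hd⟩ := exists_add_of_le hSc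
      have h4 : (d : ℝ≥0∞) < T (Nat.nth (fun k => (y k).1 = (y k).2) m) := by
        rw [Finset.sum_range_succ, ← hc, hd, ENNReal.coe_add] at hlt
        exact (ENNReal.add_lt_add_iff_left ENNReal.coe_ne_top).1 hlt
      rw [hd, h.timeTogether_meeting hc.symm h4.le]
      exact (ENNReal.add_lt_add_iff_left hfm).2 h4
  -- The index `k` of the interval containing `S` lies after all earlier meetings and not after the
  -- `n`-th, a range in which the mouse stays put.
  obtain ⟨k, hk1, hk2⟩ := exists_sum_range_le_lt h.tsum_hold S
  have h5 : k ≤ Nat.nth (fun k => (y k).1 = (y k).2) n := by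
    by_contra! h6
    exact absurd (hS2.trans_le (hJmono h6)) (not_lt.2 hk1)
  have h6 : ∀ m < n, Nat.nth (fun k => (y k).1 = (y k).2) m < k := by
    intro m hm
    by_contra! h7
    exact absurd (hk2.trans_le (hJmono (Nat.succ_le_succ h7))) (not_lt.2 (hS3 m hm))
  have h7 := congrArg Prod.snd (h.path_eq S k hk1 hk2)
  rw [h.mouse_eq h5 fun j hj hj' => h.not_meeting_of_lt (fun m hm => (h6 m hm).trans_le hj) hj']
  exact h7

end IsMeetingPath

theorem inverseTime_zero : inverseTime C M 0 ω = 0 := by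
  refine le_antisymm (le_of_forall_pos_le_add fun ε hε => ?_) zero_le
  rw [zero_add]
  exact csInf_le (OrderBot.bddBelow _) ⟨hε, by simp⟩

end Path

/-! ### From the law of states and holding times to the law of the process. -/

section ProcessLaw

variable {E : Type*}

/-- The second alternative lets the search stop on explosive sequences too, so that `pathOfJumps` is
defined and measurable everywhere. -/
theorem exists_lt_sum_or_tsum_le (z : ℕ → E × ℝ≥0∞) (t : ℝ≥0) :
    ∃ n, t < ∑ k ∈ Finset.range (n + 1), (z k).2 ∨ ∑' k, (z k).2 ≤ t := by
  by_cases h : ∑' k, (z k).2 ≤ t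
  · exact ⟨0, Or.inr h⟩
  · rw [not_le, ENNReal.tsum_eq_iSup_nat, lt_iSup_iff] at h
    obtain ⟨n, hn⟩ := h
    exact ⟨n, Or.inl (hn.trans_le (Finset.sum_le_sum_of_subset (Finset.range_mono n.le_succ)))⟩

/-- The path with given successive states and holding times. -/
noncomputable def pathOfJumps (z : ℕ → E × ℝ≥0∞) (t : ℝ≥0) : E :=
  (z (Nat.find (exists_lt_sum_or_tsum_le z t))).1

theorem pathOfJumps_eq {z : ℕ → E × ℝ≥0∞} (hz : ∑' k, (z k).2 = ∞) {t : ℝ≥0} {n : ℕ}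
    (h1 : ∑ k ∈ Finset.range n, (z k).2 ≤ t) (h2 : t < ∑ k ∈ Finset.range (n + 1), (z k).2) :
    pathOfJumps z t = (z n).1 := by
  rw [pathOfJumps, (Nat.find_eq_iff _).2 ⟨Or.inl h2, fun m hm h3 => ?_⟩]
  rcases h3 with h3 | h3
  · exact absurd ((Finset.sum_le_sum_of_subset (Finset.range_mono hm)).trans h1) (not_le.2 h3)
  · rw [hz] at h3
    exact ENNReal.coe_ne_top (top_le_iff.1 h3)

variable [MeasurableSpace E]

theorem measurable_pathOfJumps : Measurable (pathOfJumps (E := E)) := by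
  refine measurable_pi_lambda _ fun t => ?_
  have hm : ∀ k, Measurable fun z : ℕ → E × ℝ≥0∞ => (z k).2 := fun k =>
    measurable_snd.comp (measurable_pi_apply k)
  have h1 : Measurable fun z : ℕ → E × ℝ≥0∞ => Nat.find (exists_lt_sum_or_tsum_le z t) := by
    refine measurable_find _ fun n => ?_
    exact (measurableSet_lt measurable_const (Finset.measurable_fun_sum _ fun k _ => hm k)).union
      (measurableSet_le (Measurable.tsum hm) measurable_const)
  have h2 : Measurable fun p : (ℕ → E × ℝ≥0∞) × ℕ => (p.1 p.2).1 :=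
    measurable_from_prod_countable_left fun n => measurable_fst.comp (measurable_pi_apply n)
  exact h2.comp (measurable_id.prodMk h1)

variable [Countable E] [MeasurableSingletonClass E] {q : E → E → ℝ} {Ω Ω' : Type*}
  [MeasurableSpace Ω] [MeasurableSpace Ω'] {P : Measure Ω} {P' : Measure Ω'}
  {X : ℝ≥0 → Ω → E} {X' : ℝ≥0 → Ω' → E}

/-- `X` itself is not assumed measurable; its almost sure equality with a measurable functional of
`(Y, T)` gives it a law. -/
theorem ae_eq_pathOfJumps {Y : ℕ → Ω → E} {T : ℕ → Ω → ℝ≥0∞}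
    (hX : ∀ᵐ ω ∂P, ∑' k, T k ω = ∞ ∧
      ∀ (t : ℝ≥0) (n : ℕ), ∑ k ∈ Finset.range n, T k ω ≤ t →
        t < ∑ k ∈ Finset.range (n + 1), T k ω → X t ω = Y n ω) :
    (fun ω t => X t ω) =ᵐ[P] fun ω => pathOfJumps fun k => (Y k ω, T k ω) := by
  filter_upwards [hX] with ω hω
  funext t
  obtain ⟨n, h1, h2⟩ := exists_sum_range_le_lt hω.1 t
  rw [hω.2 t n h1 h2, pathOfJumps_eq (z := fun k => (Y k ω, T k ω)) hω.1 h1 h2]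

/-- The `Q`-matrix and the initial distribution determine the law of a Markov chain. -/
theorem IsMarkovChain.identDistrib [IsFiniteMeasure P] [IsFiniteMeasure P'] (hq : IsQMatrix q)
    (hX : IsMarkovChain q X P) (hX' : IsMarkovChain q X' P')
    (h0 : IdentDistrib (X 0) (X' 0) P P') :
    IdentDistrib (fun ω t => X t ω) (fun ω t => X' t ω) P P' := by
  obtain ⟨Y, T, h, hXY⟩ := hX
  obtain ⟨Y', T', h', hXY'⟩ := hX'
  have h1 := ae_eq_pathOfJumps hXY
  have h2 := ae_eq_pathOfJumps hXY'
  have hm := measurable_pathOfJumps.comp h.measurable_prodMk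
  have hm' := measurable_pathOfJumps.comp h'.measurable_prodMk
  have hlaw := h.map_eq hq h' fun i => by
    calc P {ω | Y 0 ω = i} = P (X 0 ⁻¹' {i}) := by
          refine measure_congr (Filter.eventuallyEq_set.2 ?_)
          filter_upwards [ae_eq_state_zero h hXY] with ω hω
          simp [hω]
      _ = P' (X' 0 ⁻¹' {i}) := h0.measure_mem_eq (measurableSet_singleton i)
      _ = P' {ω | Y' 0 ω = i} := by
          refine measure_congr (Filter.eventuallyEq_set.2 ?_)
          filter_upwards [ae_eq_state_zero h' hXY'] with ω hω
          simp [hω]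
  refine ⟨⟨_, hm, h1⟩, ⟨_, hm', h2⟩, ?_⟩
  rw [Measure.map_congr h1, Measure.map_congr h2]
  have h3 := congrArg (Measure.map pathOfJumps) hlaw
  rw [Measure.map_map measurable_pathOfJumps h.measurable_prodMk,
    Measure.map_map measurable_pathOfJumps h'.measurable_prodMk] at h3
  exact h3

end ProcessLaw

/-! ### Almost every path is a meeting path; conclusion. -/

section Meetings

variable {E : Type*} [MeasurableSpace E] [Countable E] [MeasurableSingletonClass E]
  {q : E → E → ℝ} {Ω : Type*} [MeasurableSpace Ω] {P : Measure Ω} [IsFiniteMeasure P]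
  {C M : ℝ≥0 → Ω → E} {Y : ℕ → Ω → E × E} {T : ℕ → Ω → ℝ≥0∞}

theorem ae_isMeetingPath (hq : IsQMatrix q) (hirr : IsIrreducible q)
    (hpos : ∀ x, IsPositiveRecurrentState q x) (h : IsJumpHold (catMouseMatrix q) Y T P)
    (hXY : ∀ᵐ ω ∂P, ∑' k, T k ω = ∞ ∧
      ∀ (t : ℝ≥0) (n : ℕ), ∑ k ∈ Finset.range n, T k ω ≤ t →
        t < ∑ k ∈ Finset.range (n + 1), T k ω → (C t ω, M t ω) = Y n ω) :
    ∀ᵐ ω ∂P, IsMeetingPath (fun k => Y k ω) (fun k => T k ω) C M ω := by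
  have hcm := isQMatrix_catMouseMatrix hq
  filter_upwards [hXY, h.hold_pos hcm, h.hold_lt_top hcm, h.mouse_const hq,
    h.ae_infinite_meetings hq (iInf_avoidProb_diag hq hirr hpos)] with ω h1 h2 h3 h4 h5
  -- Exit rate `0` for the cat would leave a one-point state space, where cat and mouse are never
  -- apart.
  refine ⟨h2, h1.1, h1.2, h5, h4, fun k hk => (h3 k).resolve_left fun h6 => hk ?_⟩
  rw [exitRate_catMouseMatrix hq] at h6
  have := subsingleton_of_exitRate_eq_zero hq hirr (le_antisymm h6 (exitRate_nonneg hq _))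
  exact Subsingleton.elim _ _

end Meetings

end CatMouse

theorem mainTheorem10 {E : Type*} [Countable E] [MeasurableSpace E] [MeasurableSingletonClass E]
    (q : E → E → ℝ) (hq : CatMouse.IsQMatrix q) (hirr : CatMouse.IsIrreducible q)
    (hpos : ∀ x, CatMouse.IsPositiveRecurrentState q x)
    {Ω : Type*} [MeasurableSpace Ω] (P : Measure Ω) [IsProbabilityMeasure P]
    (C M : ℝ≥0 → Ω → E)
    (hCM : CatMouse.IsMarkovChain (CatMouse.catMouseMatrix q) (fun t ω => (C t ω, M t ω)) P) :
    -- `S` is a right inverse of `U`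
    (∀ᵐ ω ∂P, ∀ t : ℝ≥0,
      CatMouse.timeTogether C M (CatMouse.inverseTime C M t ω) ω = (t : ℝ≥0∞)) ∧
    -- the cat and the time-changed mouse are Markov chains with the same `Q`-matrix `q`
    CatMouse.IsMarkovChain q C P ∧
    CatMouse.IsMarkovChain q (fun t ω => M (CatMouse.inverseTime C M t ω) ω) P ∧
    (∀ᵐ ω ∂P, M (CatMouse.inverseTime C M 0 ω) ω = M 0 ω) ∧
    -- same distribution (as processes) as the cat, for a common initial distribution
    (IdentDistrib (C 0) (M 0) P P →
      IdentDistrib (fun ω t => M (CatMouse.inverseTime C M t ω) ω) (fun ω t => C t ω) P P) ∧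
    -- same distribution as any Markov chain with `Q`-matrix `q` started like the mouse
    (∀ {Ω' : Type*} [MeasurableSpace Ω'] (P' : Measure Ω') [IsProbabilityMeasure P']
      (C' : ℝ≥0 → Ω' → E), CatMouse.IsMarkovChain q C' P' → IdentDistrib (C' 0) (M 0) P' P →
      IdentDistrib (fun ω t => M (CatMouse.inverseTime C M t ω) ω)
        (fun ω t => C' t ω) P P') := by
  obtain ⟨Y, T, h, hXY⟩ := hCM
  have hpath := CatMouse.ae_isMeetingPath hq hirr hpos h hXY
  have hmeet := h.meetings hq (CatMouse.iInf_avoidProb_diag hq hirr hpos)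
  have htop := hmeet.tsum_hold_eq_top hq hpos
  have hC : CatMouse.IsMarkovChain q C P := by
    refine ⟨_, T, h.cat hq, ?_⟩
    filter_upwards [hXY] with ω hω
    exact ⟨hω.1, fun t n h1 h2 => congrArg Prod.fst (hω.2 t n h1 h2)⟩
  have hM : CatMouse.IsMarkovChain q (fun t ω => M (CatMouse.inverseTime C M t ω) ω) P := by
    refine ⟨_, _, hmeet, ?_⟩
    filter_upwards [hpath, htop] with ω h1 h2
    exact ⟨h2, fun t n h3 h4 => (h1.inverseTime_spec h3 h4).2⟩
  have hM0 : ∀ ω, M (CatMouse.inverseTime C M 0 ω) ω = M 0 ω := fun ω => by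
    rw [CatMouse.inverseTime_zero]
  refine ⟨?_, hC, hM, Filter.Eventually.of_forall hM0, fun h0 => ?_, fun P' _ C' hC' h0 => ?_⟩
  -- This also shows that `S(t)` is a genuine infimum: for `t > 0` the value `sInf ∅ = 0` would give
  -- `U(S(t)) = 0`.
  · filter_upwards [hpath, htop] with ω h1 h2 t
    obtain ⟨n, h3, h4⟩ := CatMouse.exists_sum_range_le_lt h2 t
    exact (h1.inverseTime_spec h3 h4).1
  · refine hM.identDistrib hq hC ?_
    simp only [hM0]
    exact h0.symm
  · refine hM.identDistrib hq hC' ?_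
    simp only [hM0]
    exact h0.symm
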